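/- **Setting.** Let $V$ be a set of program variables, each variable $x$ having a nonempty set $T_x$ of values (neither $V$ nor the $T_x$ need be finite or countable). For a finite set $X\subseteq V$ let $\ell^2[X]$ be the Hilbert space with orthonormal basis $|m\rangle$, $m$ ranging over the assignments $m\in\prod_{x\in X}T_x$; let $\mathcal H:=\ell^2\bigl(\prod_{x\in V}T_x\bigr)$. An operator $A$ on $\ell^2[X]$ is also regarded as the operator $A\otimes\mathrm{id}$ on $\mathcal H$. Operators are bounded. A mixed memory is a positive trace-class operator (of arbitrary trace); infinite sums of operators converge in the trace norm. A mixed memory $\rho$ on $\mathcal H\otimes\mathcal H$ is separable if $\rho=\sum_i\rho_i\otimes\rho_i'$ for mixed memories $\rho_i,\rho_i'$ on $\mathcal H$; $\operatorname{tr}_1,\operatorname{tr}_2$ are the partial traces over the first and second factor. An expectation is a positive operator on $\mathcal H\otimes\mathcal H$. A binary measurement $M$ on $\ell^2[X]$ is a pair of operators $M_{\mathsf{true}},M_{\mathsf{false}}$ with $M_{\mathsf{true}}^*M_{\mathsf{true}}+M_{\mathsf{false}}^*M_{\mathsf{false}}=\mathrm{id}$; put $\downarrow_t(\rho):=M_t\,\rho\,M_t^*$.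 **Programs.** $c,d ::= \mathbf{apply}\ U\ \mathbf{to}\ X \mid X\leftarrow\psi \mid \mathbf{if}\ M[X]\ \mathbf{then}\ c\ \mathbf{else}\ d \mid \mathbf{while}\ M[X]\ c \mid c;d \mid \mathbf{skip}$, where $X\subseteq V$ is finite, $U$ is an isometry on $\ell^2[X]$, $\psi\in\ell^2[X]$ is a unit vector and $M$ is a binary measurement on $\ell^2[X]$. The semantics on mixed memories $\rho$ on $\mathcal H$ is $$[\![\mathbf{apply}\ U\ \mathbf{to}\ X]\!](\rho)=U\rho U^*,\qquad [\![X\leftarrow\psi]\!](\rho)=\operatorname{tr}_X\rho\otimes\psi\psi^*,$$ $$[\![\mathbf{if}\ M[X]\ \mathbf{then}\ c\ \mathbf{else}\ d]\!](\rho)=[\![c]\!](\downarrow_{\mathsf{true}}(\rho))+[\![d]\!](\downarrow_{\mathsf{false}}(\rho)),$$ $$[\![\mathbf{while}\ M[X]\ c]\!](\rho)=\sum_{n=0}^\infty\downarrow_{\mathsf{false}}\bigl(([\![c]\!]\circ\downarrow_{\mathsf{true}})^n(\rho)\bigr),\qquad [\![c;d]\!]=[\![d]\!]\circ[\![c]\!],\qquad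 [\![\mathbf{skip}]\!]=\mathrm{id}.$$ A program $c$ is terminating if $\operatorname{tr}[\![c]\!](\rho)=\operatorname{tr}\rho$ for all mixed memories $\rho$. **Judgments.** For expectations $A,B$ and programs $c,d$, the judgment $\mathrm{rhl}\{A\}\,c\sim d\,\{B\}$ holds iff for every separable mixed memory $\rho$ on $\mathcal H\otimes\mathcal H$ there is a separable mixed memory $\rho'$ on $\mathcal H\otimes\mathcal H$ with $$\operatorname{tr}_2\rho'=[\![c]\!](\operatorname{tr}_2\rho),\qquad \operatorname{tr}_1\rho'=[\![d]\!](\operatorname{tr}_1\rho),\qquad \operatorname{tr}A\rho\le\operatorname{tr}B\rho'.$$ **Theorem (soundness of the rule JointWhile).** Let $c,d$ be programs, $X,Y\subseteq V$ finite, $M$ and $N$ binary measurements on $\ell^2[X]$ and $\ell^2[Y]$, and $A,B$ expectations. For $t,u\in\{\mathsf{true},\mathsf{false}\}$ and an operator $C$ on $\mathcal H\otimes\mathcal H$ put $$\downarrow^*_{t,u}(C):=(M_t\otimes\mathrm{id})^*(\mathrm{id}\otimes N_u)^*\,C\,(\mathrm{id}\otimes N_u)(M_t\otimes\mathrm{id}).$$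 Suppose that $\mathrm{rhl}\{A\}\,c\sim d\,\{\downarrow^*_{\mathsf{true},\mathsf{true}}(A)+\downarrow^*_{\mathsf{false},\mathsf{false}}(B)\}$ holds and that $c$, $d$, $\mathbf{while}\ M[X]\ c$ and $\mathbf{while}\ N[Y]\ d$ are terminating. Then $$\mathrm{rhl}\{\downarrow^*_{\mathsf{true},\mathsf{true}}(A)+\downarrow^*_{\mathsf{false},\mathsf{false}}(B)\}\ (\mathbf{while}\ M[X]\ c)\sim(\mathbf{while}\ N[Y]\ d)\ \{B\}$$ holds. -/

import Mathlib

open scoped ENNReal Topology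

namespace QRHL

noncomputable section

/-! ### The Hilbert spaces `ℓ²(I)` -/

/-- The complex Hilbert space `ℓ²(I)` with orthonormal basis `|i⟩`, `i ∈ I`; the set `I` is
arbitrary. -/
abbrev Ell2 (I : Type*) := lp (fun _ : I => ℂ) 2

/-- Bounded operators on `ℓ²(I)`. -/
abbrev Op (I : Type*) := Ell2 I →L[ℂ] Ell2 I

section Basics

variable {I J : Type*}

theorem memLp2_iff (f : I → ℂ) : Memℓp f 2 ↔ Summable fun i => ‖f i‖ ^ 2 := by
  rw [memℓp_gen_iff (by norm_num)]
  simp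

theorem hasSum_sq (f : Ell2 I) : HasSum (fun i => ‖f i‖ ^ 2) (‖f‖ ^ 2) := by
  simpa using lp.hasSum_norm (p := 2) (by norm_num) f

theorem norm_le_of_sq_le {f : Ell2 I} {C : ℝ} (hC : 0 ≤ C)
    (h : ∑' i, ‖f i‖ ^ 2 ≤ C ^ 2) : ‖f‖ ≤ C := by
  rw [(hasSum_sq f).tsum_eq] at h
  exact le_of_sq_le_sq h hC

open Classical in
/-- The basis vector `|i⟩`. -/
def ket (i : I) : Ell2 I := lp.single 2 i (1 : ℂ)

/-- The unitary `ℓ²(I) ≃ ℓ²(J)` that renames the basis along a bijection: `|i⟩ ↦ |e i⟩`. -/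
def reindex (e : I ≃ J) : Ell2 I ≃ₗᵢ[ℂ] Ell2 J where
  toFun f := ⟨fun j => f (e.symm j), (memLp2_iff _).2
    ((hasSum_sq f).summable.comp_injective e.symm.injective)⟩
  invFun f := ⟨fun i => f (e i), (memLp2_iff _).2
    ((hasSum_sq f).summable.comp_injective e.injective)⟩
  map_add' _ _ := rfl
  map_smul' _ _ := rfl
  left_inv f := by ext i; simp
  right_inv f := by ext i; simp
  norm_map' f := by
    have h1 := hasSum_sq f
    have h2 := hasSum_sq (⟨fun j => f (e.symm j), (memLp2_iff _).2
      ((hasSum_sq f).summable.comp_injective e.symm.injective)⟩ : Ell2 J)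
    have h3 := (e.symm.hasSum_iff (f := fun i => ‖f i‖ ^ 2)).2 h1
    have h4 := h2.unique h3
    exact (sq_eq_sq₀ (norm_nonneg _) (norm_nonneg _)).1 h4

/-- The operator `id ⊗ ⟨j| : ℓ²(I × J) → ℓ²(I)`, that is, `(slice j Ψ)(i) = Ψ(i, j)`. -/
def slice (j : J) : Ell2 (I × J) →L[ℂ] Ell2 I :=
  LinearMap.mkContinuous
    { toFun := fun Ψ => ⟨fun i => Ψ (i, j), (memLp2_iff _).2
        ((hasSum_sq Ψ).summable.comp_injective (Prod.mk_left_injective j))⟩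
      map_add' := fun _ _ => rfl
      map_smul' := fun _ _ => rfl } 1 (by
    intro Ψ
    rw [one_mul]
    refine norm_le_of_sq_le (norm_nonneg _) ?_
    rw [← (hasSum_sq Ψ).tsum_eq]
    exact ((hasSum_sq Ψ).summable.comp_injective
      (Prod.mk_left_injective j)).tsum_le_tsum_of_inj (fun i => (i, j))
      (Prod.mk_left_injective j) (fun _ _ => by positivity) (fun _ => le_rfl)
      (hasSum_sq Ψ).summable)

theorem slice_apply (j : J) (Ψ : Ell2 (I × J)) (i : I) : slice j Ψ i = Ψ (i, j) := rfl

theorem hasSum_slice_sq (Ψ : Ell2 (I × J)) :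
    HasSum (fun j : J => ‖slice j Ψ‖ ^ 2) (‖Ψ‖ ^ 2) := by
  have h := (Equiv.prodComm J I).hasSum_iff (f := fun p => ‖Ψ p‖ ^ 2) |>.2 (hasSum_sq Ψ)
  exact h.prod_fiberwise (fun j => hasSum_sq (slice j Ψ))

theorem summable_ampL (A : Op I) (Ψ : Ell2 (I × J)) :
    Summable (fun p : I × J => ‖A (slice p.2 Ψ) p.1‖ ^ 2) ∧
      ∑' p : I × J, ‖A (slice p.2 Ψ) p.1‖ ^ 2 ≤ (‖A‖ * ‖Ψ‖) ^ 2 := by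
  have hb : ∀ j : J, ‖A (slice j Ψ)‖ ^ 2 ≤ ‖A‖ ^ 2 * ‖slice j Ψ‖ ^ 2 := fun j => by
    rw [← mul_pow]
    exact pow_le_pow_left₀ (norm_nonneg _) (A.le_opNorm _) 2
  have hs : Summable (fun j : J => ‖A (slice j Ψ)‖ ^ 2) :=
    Summable.of_nonneg_of_le (fun _ => by positivity) hb
      ((hasSum_slice_sq Ψ).summable.mul_left _)
  have h1 : Summable (fun q : J × I => ‖A (slice q.1 Ψ) q.2‖ ^ 2) := by
    rw [summable_prod_of_nonneg (fun _ => by positivity)]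
    refine ⟨fun j => (hasSum_sq (A (slice j Ψ))).summable, ?_⟩
    convert hs using 2 with j
    exact (hasSum_sq (A (slice j Ψ))).tsum_eq
  refine ⟨(Equiv.prodComm I J).summable_iff.2 h1, ?_⟩
  have h2 : ∑' p : I × J, ‖A (slice p.2 Ψ) p.1‖ ^ 2
      = ∑' q : J × I, ‖A (slice q.1 Ψ) q.2‖ ^ 2 :=
    (Equiv.prodComm I J).tsum_eq (fun q : J × I => ‖A (slice q.1 Ψ) q.2‖ ^ 2)
  rw [h2, h1.tsum_prod' (fun j => (hasSum_sq (A (slice j Ψ))).summable)]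
  simp only [(hasSum_sq (A (slice _ Ψ))).tsum_eq]
  calc ∑' j, ‖A (slice j Ψ)‖ ^ 2 ≤ ∑' j, ‖A‖ ^ 2 * ‖slice j Ψ‖ ^ 2 :=
        hs.tsum_le_tsum hb ((hasSum_slice_sq Ψ).summable.mul_left _)
    _ = (‖A‖ * ‖Ψ‖) ^ 2 := by
        rw [tsum_mul_left, (hasSum_slice_sq Ψ).tsum_eq, mul_pow]

/-- The operator `A ⊗ id` on `ℓ²(I × J)`. -/
def ampL (A : Op I) : Op (I × J) :=
  LinearMap.mkContinuous
    { toFun := fun Ψ => ⟨fun p => A (slice p.2 Ψ) p.1, (memLp2_iff _).2 (summable_ampL A Ψ).1⟩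
      map_add' := fun Ψ Φ => by
        ext p
        simp only [map_add, lp.coeFn_add, Pi.add_apply]
      map_smul' := fun c Ψ => by ext p; simp } ‖A‖
    (fun Ψ => norm_le_of_sq_le (by positivity) (summable_ampL A Ψ).2)

theorem ampL_apply (A : Op I) (Ψ : Ell2 (I × J)) (p : I × J) :
    ampL A Ψ p = A (slice p.2 Ψ) p.1 := rfl

/-- Conjugation of an operator by the unitary `reindex e`. -/
def Op.reindex (e : I ≃ J) (A : Op I) : Op J :=
  (QRHL.reindex e : Ell2 I →L[ℂ] Ell2 J) ∘L A ∘L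
    ((QRHL.reindex e).symm : Ell2 J →L[ℂ] Ell2 I)

/-- The operator `id ⊗ B` on `ℓ²(I × J)`. -/
def ampR (B : Op J) : Op (I × J) := Op.reindex (Equiv.prodComm J I) (ampL B)

/-- The tensor product `A ⊗ B` of operators, acting on `ℓ²(I × J)`. -/
def tensor (A : Op I) (B : Op J) : Op (I × J) := ampL A ∘L ampR B

end Basics

/-! ### Trace, trace norm, mixed states, partial trace -/

section Trace

variable {I J : Type*}

/-- The trace of a positive operator, as an element of `[0, ∞]`. -/
def posTrace (P : Op I) : ℝ≥0∞ := ∑' i, ENNReal.ofReal (inner ℂ (ket i) (P (ket i))).re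

/-- The absolute value `|A| = (A† A)^(1/2)` of a bounded operator on a Hilbert space. -/
def opAbs {H : Type*} [NormedAddCommGroup H] [InnerProductSpace ℂ H] [CompleteSpace H]
    (A : H →L[ℂ] H) : H →L[ℂ] H := CFC.abs A

/-- The trace norm `tr |A|` of an arbitrary bounded operator. -/
def traceNorm (A : Op I) : ℝ≥0∞ := posTrace (opAbs A)

/-- The trace `∑ᵢ ⟨i| A |i⟩` of a trace-class operator. -/
def trace (A : Op I) : ℂ := ∑' i, inner ℂ (ket i) (A (ket i))

/-- A mixed state: a positive trace-class operator (not necessarily normalized). -/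
def IsMixed (ρ : Op I) : Prop := ρ.IsPositive ∧ traceNorm ρ < ∞

/-- The family `f` sums to `σ` with respect to the trace norm. -/
def TraceHasSum {ι : Type*} (f : ι → Op I) (σ : Op I) : Prop :=
  Filter.Tendsto (fun F : Finset ι => traceNorm (σ - ∑ i ∈ F, f i)) Filter.atTop (𝓝 0)

open Classical in
/-- The sum of the family `f` with respect to the trace norm (`0` if `f` is not summable). -/
def traceSum {ι : Type*} (f : ι → Op I) : Op I :=
  if h : ∃ σ, TraceHasSum f σ then h.choose else 0

/-- Partial trace over the second factor: `∑ⱼ (id ⊗ ⟨j|) ρ (id ⊗ |j⟩)`. -/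
def ptraceR (ρ : Op (I × J)) : Op I :=
  traceSum fun j : J => slice j ∘L ρ ∘L (slice j).adjoint

/-- Partial trace over the first factor. -/
def ptraceL (ρ : Op (I × J)) : Op J := ptraceR (Op.reindex (Equiv.prodComm I J) ρ)

/-- A mixed state on a bipartite system is separable if it is a sum, converging in the trace norm,
of tensor products of mixed states. -/
def IsSeparable (ρ : Op (I × J)) : Prop :=
  IsMixed ρ ∧ ∃ (ι : Type) (σ : ι → Op I) (τ : ι → Op J),
    (∀ k, IsMixed (σ k)) ∧ (∀ k, IsMixed (τ k)) ∧ TraceHasSum (fun k => tensor (σ k) (τ k)) ρ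

end Trace

/-! ### Programs -/

/-- A binary measurement on `ℓ²(I)`, given by its two Kraus operators. -/
structure BinMeas (I : Type*) where
  op : Bool → Op I
  complete : (op true).adjoint ∘L op true + (op false).adjoint ∘L op false =
    ContinuousLinearMap.id ℂ (Ell2 I)

universe u v

section Programs

variable {V : Type u}

/-- Assignments to all program variables; the variable `x` has type `T x`. -/
abbrev Assign (T : V → Type v) := ∀ x : V, T x

/-- Assignments to the variables in `X`. -/
abbrev AssignOn (T : V → Type v) (X : Finset V) := ∀ x : {x : V // x ∈ X}, T x

/-- Assignments to the variables outside `X`. -/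
abbrev AssignOff (T : V → Type v) (X : Finset V) := ∀ x : {x : V // ¬ x ∈ X}, T x

/-- Quantum programs over the variables `V`. -/
inductive Prog (T : V → Type v) : Type (max u v)
  | apply (X : Finset V) (U : Ell2 (AssignOn T X) →ₗᵢ[ℂ] Ell2 (AssignOn T X))
  | init (X : Finset V) (ψ : Ell2 (AssignOn T X)) (hψ : ‖ψ‖ = 1)
  | ifte (X : Finset V) (M : BinMeas (AssignOn T X)) (c d : Prog T)
  | loop (X : Finset V) (M : BinMeas (AssignOn T X)) (c : Prog T)
  | seq (c d : Prog T)
  | skip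

variable {T : V → Type v}

open Classical in
/-- The canonical identification of assignments with pairs of an assignment on `X` and an
assignment outside `X`. -/
def splitEquiv (T : V → Type v) (X : Finset V) : Assign T ≃ AssignOn T X × AssignOff T X :=
  Equiv.piEquivPiSubtypeProd (fun x => x ∈ X) T

/-- The operator `A` on the variables `X`, seen as the operator `A ⊗ id` on all variables. -/
def onVars (X : Finset V) (A : Op (AssignOn T X)) : Op (Assign T) :=
  Op.reindex (splitEquiv T X).symm (ampL A)

/-- `ρ ↦ K ρ K†`. -/
def sandwich {I : Type*} (K ρ : Op I) : Op I := K ∘L ρ ∘L K.adjoint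

/-- The map `↓_t`: the measurement `M` on the variables `X` yields the outcome `t`
(no renormalization). -/
def restrict (X : Finset V) (M : BinMeas (AssignOn T X)) (t : Bool) (ρ : Op (Assign T)) :
    Op (Assign T) :=
  sandwich (onVars X (M.op t)) ρ

/-- Denotational semantics, a map on the mixed memories over all program variables. -/
def Prog.denot : Prog T → Op (Assign T) → Op (Assign T)
  | .apply X U, ρ => sandwich (onVars X U.toContinuousLinearMap) ρ
  | .init X ψ _, ρ => Op.reindex (splitEquiv T X).symm
      (tensor (InnerProductSpace.rankOne ℂ ψ ψ) (ptraceL (Op.reindex (splitEquiv T X) ρ)))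
  | .ifte X M c d, ρ => c.denot (restrict X M true ρ) + d.denot (restrict X M false ρ)
  | .loop X M c, ρ =>
      traceSum fun n : ℕ => restrict X M false ((fun σ => c.denot (restrict X M true σ))^[n] ρ)
  | .seq c d, ρ => d.denot (c.denot ρ)
  | .skip, ρ => ρ

/-- A program is terminating if it preserves the trace of every mixed memory. -/
def Prog.Terminating (c : Prog T) : Prop :=
  ∀ ρ : Op (Assign T), IsMixed ρ → trace (c.denot ρ) = trace ρ

/-- The judgment `{A} c ~ d {B}` for expectations (positive bounded operators) `A`, `B` on two
copies of the memory. -/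
def RHL (A : Op (Assign T × Assign T)) (c d : Prog T) (B : Op (Assign T × Assign T)) : Prop :=
  ∀ ρ : Op (Assign T × Assign T), IsSeparable ρ →
    ∃ ρ' : Op (Assign T × Assign T), IsSeparable ρ' ∧
      ptraceR ρ' = c.denot (ptraceR ρ) ∧
      ptraceL ρ' = d.denot (ptraceL ρ) ∧
      (trace (A ∘L ρ)).re ≤ (trace (B ∘L ρ')).re

/-- `↓*_{t,u}(A) = (M_t on X₁)† (N_u on Y₂)† A (N_u on Y₂) (M_t on X₁)`. -/
def restrictStar (X Y : Finset V) (M : BinMeas (AssignOn T X)) (N : BinMeas (AssignOn T Y))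
    (t u : Bool) (A : Op (Assign T × Assign T)) : Op (Assign T × Assign T) :=
  (ampL (onVars X (M.op t))).adjoint ∘L (ampR (onVars Y (N.op u))).adjoint ∘L A ∘L
    ampR (onVars Y (N.op u)) ∘L ampL (onVars X (M.op t))

end Programs

end

end QRHL

open QRHL

namespace QRHL

noncomputable section


/-! ### Basis vectors and Hilbert–Schmidt sums -/

section HilbertSchmidt

variable {I J K : Type*}

/-! Run both loops in lockstep and keep only the branches in which the two guards agree. Put `ρ₀ =
ρ`, and let `ρₙ₊₁` be the separable state that the body judgment supplies for the part of `ρₙ` on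
which both guards yield true. Let `τ` be the sum over `n` of the parts of `ρₙ` on which both guards
yield false.

Marginals. Selecting an outcome on one memory can only shrink the marginal on the other. Hence the
marginals of `ρₙ` lie below the `n`-th loop states of the two single loops (`mixedLE_loopState`),
and the marginals of `τ` lie below the two loop outputs (`mixedLE_loop`), with positive defects `R`
and `L`. Both loops terminate and both marginals of `τ` have the trace of `τ`, so `R` and `L` have
equal trace. The normalized product of `R` and `L` is a separable state `κ` with these marginals
(`exists_coupling`), and `τ + κ` is the required witness.

Expectations. Let `aₙ` be the value of `A` on the both-true part of `ρₙ` and `bₙ` the value of `B`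
on the both-false part. The body judgment says `aₙ ≤ aₙ₊₁ + bₙ₊₁`, so `a₀ + b₀ ≤ aₙ + ∑_{k ≤ n} bₖ`
(`le_tsum_of_le_succ`). Termination of a loop forces the trace of its `n`-th state to 0
(`tendsto_posTrace_loopState`), hence `aₙ → 0`. The precondition's value is thus at most that of `B`
on `τ`, and adding `κ` can only increase the latter.

The analysis takes place in `[0, ∞]`: writing a positive operator as a square turns traces into
Hilbert–Schmidt sums, where Tonelli applies, and a positive operator is determined by its quadratic
form (`eq_of_quad`). -/

theorem inner_ket_left (i : I) (f : Ell2 I) : inner ℂ (ket i) f = f i := by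
  classical
  rw [ket, lp.inner_single_left]
  simp

theorem hasSum_ket (f : Ell2 I) : HasSum (fun i => f i • ket i) f := by
  classical
  convert lp.hasSum_single (p := 2) (by norm_num) f using 2 with i
  rw [ket, ← lp.single_smul]
  simp

theorem ext_ket {E : Type*} [NormedAddCommGroup E] [NormedSpace ℂ E] {S T : Ell2 I →L[ℂ] E}
    (h : ∀ i, S (ket i) = T (ket i)) : S = T := by
  ext1 f
  have hS := S.hasSum (hasSum_ket f)
  have hT := T.hasSum (hasSum_ket f)
  simp only [map_smul, h] at hS hT
  exact hS.unique hT

theorem ext_inner_self {H : Type*} [NormedAddCommGroup H] [InnerProductSpace ℂ H]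
    {S T : H →L[ℂ] H} (h : ∀ x, inner ℂ x (S x) = inner ℂ x (T x)) : S = T := by
  have := (ext_inner_map (S : H →ₗ[ℂ] H) (T : H →ₗ[ℂ] H)).1 fun x => by
    have := congrArg (starRingEnd ℂ) (h x)
    rwa [inner_conj_symm, inner_conj_symm] at this
  exact ContinuousLinearMap.coe_injective this

/-- The squared Hilbert–Schmidt norm. -/
def hsSq (T : Ell2 I →L[ℂ] Ell2 J) : ℝ≥0∞ := ∑' i, ENNReal.ofReal (‖T (ket i)‖ ^ 2)

theorem ofReal_norm_sq (f : Ell2 I) :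
    ENNReal.ofReal (‖f‖ ^ 2) = ∑' i, ENNReal.ofReal (‖f i‖ ^ 2) := by
  rw [← (hasSum_sq f).tsum_eq]
  exact ENNReal.ofReal_tsum_of_nonneg (fun _ => by positivity) (hasSum_sq f).summable

/-- Both sides sum the squared moduli of all matrix entries, by Tonelli in either order. -/
theorem hsSq_adjoint (T : Ell2 I →L[ℂ] Ell2 J) : hsSq T.adjoint = hsSq T := by
  simp only [hsSq, ofReal_norm_sq]
  rw [ENNReal.tsum_comm]
  refine tsum_congr fun i => tsum_congr fun j => ?_
  rw [← inner_ket_left, ← inner_ket_left, ContinuousLinearMap.adjoint_inner_right, norm_inner_symm]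

theorem hsSq_comp_le (L : Ell2 J →L[ℂ] Ell2 K) (T : Ell2 I →L[ℂ] Ell2 J) :
    hsSq (L ∘L T) ≤ ENNReal.ofReal (‖L‖ ^ 2) * hsSq T := by
  rw [hsSq, hsSq, ← ENNReal.tsum_mul_left]
  refine ENNReal.tsum_le_tsum fun i => ?_
  rw [← ENNReal.ofReal_mul (by positivity), ← mul_pow]
  exact ENNReal.ofReal_le_ofReal (pow_le_pow_left₀ (norm_nonneg _) (L.le_opNorm _) 2)

theorem norm_apply_sq_le_hsSq (T : Ell2 I →L[ℂ] Ell2 J) (x : Ell2 I) :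
    ENNReal.ofReal (‖T x‖ ^ 2) ≤ hsSq T * ENNReal.ofReal (‖x‖ ^ 2) := by
  rw [← hsSq_adjoint, hsSq, ← ENNReal.tsum_mul_right, ofReal_norm_sq]
  refine ENNReal.tsum_le_tsum fun j => ?_
  rw [← ENNReal.ofReal_mul (by positivity), ← mul_pow, ← inner_ket_left,
    ← ContinuousLinearMap.adjoint_inner_left]
  exact ENNReal.ofReal_le_ofReal (pow_le_pow_left₀ (norm_nonneg _) (norm_inner_le_norm _ _) 2)

theorem norm_sq_le_hsSq (T : Ell2 I →L[ℂ] Ell2 J) : ENNReal.ofReal (‖T‖ ^ 2) ≤ hsSq T := by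
  by_cases h : hsSq T = ∞
  · simp [h]
  rw [← ENNReal.ofReal_toReal h]
  refine ENNReal.ofReal_le_ofReal ?_
  rw [← Real.sq_sqrt (ENNReal.toReal_nonneg (a := hsSq T))]
  refine pow_le_pow_left₀ (norm_nonneg _) (T.opNorm_le_bound (Real.sqrt_nonneg _) fun x => ?_) 2
  refine le_of_sq_le_sq ?_ (by positivity)
  have := norm_apply_sq_le_hsSq T x
  rw [← ENNReal.ofReal_toReal h, ← ENNReal.ofReal_mul ENNReal.toReal_nonneg,
    ENNReal.ofReal_le_ofReal_iff (by positivity)] at this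
  rwa [mul_pow, Real.sq_sqrt ENNReal.toReal_nonneg]

theorem hasSum_inner_ket (x y : Ell2 I) :
    HasSum (fun i => inner ℂ x (ket i) * inner ℂ (ket i) y) (inner ℂ x y) := by
  convert! (hasSum_ket y).mapL (innerSL ℂ x) using 1
  ext i
  rw [innerSL_apply_apply, inner_smul_right, inner_ket_left, mul_comm]

theorem summable_sq_of_hsSq {T : Ell2 I →L[ℂ] Ell2 J} (hT : hsSq T ≠ ∞) :
    Summable fun p : I × J => ‖inner ℂ (ket p.2) (T (ket p.1))‖ ^ 2 := by
  have h : ∑' p : I × J, ENNReal.ofReal (‖inner ℂ (ket p.2) (T (ket p.1))‖ ^ 2) ≠ ∞ := by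
    rw [ENNReal.tsum_prod (f := fun i j => ENNReal.ofReal (‖inner ℂ (ket j) (T (ket i))‖ ^ 2))]
    simpa only [hsSq, ofReal_norm_sq, inner_ket_left] using hT
  refine (ENNReal.summable_toReal h).congr fun p => ?_
  rw [ENNReal.toReal_ofReal (by positivity)]

/-- Cyclicity of the trace for a product of two Hilbert–Schmidt operators: after a Parseval
expansion the double series converges absolutely, so the two summations may be exchanged. -/
theorem tsum_inner_eq_tsum_inner_adjoint {S T : Ell2 I →L[ℂ] Ell2 J} (hS : hsSq S ≠ ∞)
    (hT : hsSq T ≠ ∞) :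
    ∑' i, inner ℂ (S (ket i)) (T (ket i)) =
      ∑' j, inner ℂ (T.adjoint (ket j)) (S.adjoint (ket j)) := by
  have hsum : Summable (Function.uncurry fun i j =>
      inner ℂ (S (ket i)) (ket j) * inner ℂ (ket j) (T (ket i))) := by
    -- The majorant comes from `|a b| ≤ |a|² + |b|²`.
    refine Summable.of_norm_bounded
      ((summable_sq_of_hsSq hS).add (summable_sq_of_hsSq hT)) fun p => ?_
    rw [Function.uncurry, norm_mul, norm_inner_symm]
    nlinarith [sq_nonneg (‖inner ℂ (ket p.2) (S (ket p.1))‖ - ‖inner ℂ (ket p.2) (T (ket p.1))‖),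
      sq_nonneg ‖inner ℂ (ket p.2) (S (ket p.1))‖, sq_nonneg ‖inner ℂ (ket p.2) (T (ket p.1))‖]
  calc ∑' i, inner ℂ (S (ket i)) (T (ket i))
      = ∑' i, ∑' j, inner ℂ (S (ket i)) (ket j) * inner ℂ (ket j) (T (ket i)) :=
        tsum_congr fun i => (hasSum_inner_ket _ _).tsum_eq.symm
    _ = ∑' j, ∑' i, inner ℂ (S (ket i)) (ket j) * inner ℂ (ket j) (T (ket i)) :=
        (Summable.tsum_comm hsum).symm
    _ = ∑' j, inner ℂ (T.adjoint (ket j)) (S.adjoint (ket j)) := tsum_congr fun j => by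
        rw [← (hasSum_inner_ket _ _).tsum_eq]
        refine tsum_congr fun i => ?_
        rw [ContinuousLinearMap.adjoint_inner_right, ContinuousLinearMap.adjoint_inner_left,
          mul_comm]

end HilbertSchmidt

/-! ### The trace of positive operators -/

section PosTrace

variable {I J : Type*}

section Sqrt

variable {H : Type*} [NormedAddCommGroup H] [InnerProductSpace ℂ H] [CompleteSpace H]

theorem opAbs_isPositive (A : H →L[ℂ] H) : (opAbs A).IsPositive :=
  (ContinuousLinearMap.nonneg_iff_isPositive _).1 (CFC.abs_nonneg A)

theorem norm_opAbs (A : H →L[ℂ] H) : ‖opAbs A‖ = ‖A‖ := CFC.norm_abs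

theorem opAbs_of_isPositive {P : H →L[ℂ] H} (hP : P.IsPositive) : opAbs P = P :=
  CFC.abs_of_nonneg P ((ContinuousLinearMap.nonneg_iff_isPositive P).2 hP)

/-- The square root of a positive operator. -/
def opSqrt (A : H →L[ℂ] H) : H →L[ℂ] H := CFC.sqrt A

theorem opSqrt_adjoint (A : H →L[ℂ] H) : (opSqrt A).adjoint = opSqrt A :=
  ((ContinuousLinearMap.nonneg_iff_isPositive _).1 (CFC.sqrt_nonneg A)).isSelfAdjoint.adjoint_eq

theorem opSqrt_comp_opSqrt {A : H →L[ℂ] H} (hA : A.IsPositive) : opSqrt A ∘L opSqrt A = A :=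
  CFC.sqrt_mul_sqrt_self A ((ContinuousLinearMap.nonneg_iff_isPositive A).2 hA)

/-- With `P = S ∘L S`, the trace of `P` becomes the squared Hilbert–Schmidt norm of `S`; most trace
estimates below begin this way. -/
theorem exists_sqrt {P : H →L[ℂ] H} (hP : P.IsPositive) :
    ∃ S : H →L[ℂ] H, S.adjoint = S ∧ S ∘L S = P :=
  ⟨opSqrt P, opSqrt_adjoint P, opSqrt_comp_opSqrt hP⟩

end Sqrt

theorem posTrace_adjoint_comp (T : Ell2 I →L[ℂ] Ell2 J) :
    posTrace (T.adjoint ∘L T) = hsSq T := by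
  refine tsum_congr fun i => ?_
  rw [ContinuousLinearMap.comp_apply, ContinuousLinearMap.adjoint_inner_right,
    inner_self_eq_norm_sq_to_K]
  norm_cast

theorem posTrace_comp_adjoint (T : Ell2 I →L[ℂ] Ell2 J) :
    posTrace (T ∘L T.adjoint) = hsSq T := by
  rw [← hsSq_adjoint, ← posTrace_adjoint_comp, ContinuousLinearMap.adjoint_adjoint]

theorem posTrace_sq {S : Op I} (hS : S.adjoint = S) : posTrace (S ∘L S) = hsSq S := by
  rw [← posTrace_adjoint_comp, hS]

theorem posTrace_conj_sqrt (T : Ell2 I →L[ℂ] Ell2 J) {S : Op I} (hS : S.adjoint = S) :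
    posTrace (T ∘L (S ∘L S) ∘L T.adjoint) = hsSq (T ∘L S) := by
  rw [← posTrace_comp_adjoint, ContinuousLinearMap.adjoint_comp, hS]
  rfl

theorem re_inner_nonneg {P : Op I} (hP : P.IsPositive) (x : Ell2 I) :
    0 ≤ (inner ℂ x (P x)).re := hP.re_inner_nonneg_right x

theorem posTrace_add {P Q : Op I} (hP : P.IsPositive) (hQ : Q.IsPositive) :
    posTrace (P + Q) = posTrace P + posTrace Q := by
  rw [posTrace, posTrace, posTrace, ← ENNReal.tsum_add]
  refine tsum_congr fun i => ?_
  rw [← ENNReal.ofReal_add (re_inner_nonneg hP _) (re_inner_nonneg hQ _), ← Complex.add_re,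
    ← inner_add_right]
  rfl

theorem sandwich_isPositive {P : Op I} (hP : P.IsPositive) (K : Op I) :
    (sandwich K P).IsPositive := hP.conj_adjoint K

theorem sandwich_add (K P Q : Op I) : sandwich K (P + Q) = sandwich K P + sandwich K Q := by
  simp only [sandwich, ContinuousLinearMap.add_comp, ContinuousLinearMap.comp_add]

theorem posTrace_smul {r : ℝ} (hr : 0 ≤ r) (P : Op I) :
    posTrace ((r : ℂ) • P) = ENNReal.ofReal r * posTrace P := by
  rw [posTrace, posTrace, ← ENNReal.tsum_mul_left]
  refine tsum_congr fun i => ?_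
  rw [← ENNReal.ofReal_mul hr, smul_apply, inner_smul_right,
    Complex.re_ofReal_mul]

theorem posTrace_conj_le (T : Ell2 I →L[ℂ] Ell2 J) {P : Op I} (hP : P.IsPositive) :
    posTrace (T ∘L P ∘L T.adjoint) ≤ ENNReal.ofReal (‖T‖ ^ 2) * posTrace P := by
  obtain ⟨S, hS, rfl⟩ := exists_sqrt hP
  rw [posTrace_conj_sqrt T hS, posTrace_sq hS]
  exact hsSq_comp_le T S

theorem norm_le_posTrace {P : Op I} (hP : P.IsPositive) : ENNReal.ofReal ‖P‖ ≤ posTrace P := by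
  obtain ⟨S, hS, rfl⟩ := exists_sqrt hP
  have h := ContinuousLinearMap.norm_adjoint_comp_self S
  rw [hS] at h
  rw [posTrace_sq hS, h, ← sq]
  exact norm_sq_le_hsSq S

theorem norm_le_traceNorm (A : Op I) : ENNReal.ofReal ‖A‖ ≤ traceNorm A := by
  have h := norm_le_posTrace (opAbs_isPositive A)
  rwa [norm_opAbs] at h

theorem traceNorm_of_isPositive {P : Op I} (hP : P.IsPositive) : traceNorm P = posTrace P := by
  rw [traceNorm, opAbs_of_isPositive hP]

theorem isMixed_iff {ρ : Op I} : IsMixed ρ ↔ ρ.IsPositive ∧ posTrace ρ ≠ ∞ := by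
  rw [IsMixed, lt_top_iff_ne_top]
  refine and_congr_right fun h => ?_
  rw [traceNorm_of_isPositive h]

theorem IsMixed.posTrace_ne_top {ρ : Op I} (h : IsMixed ρ) : posTrace ρ ≠ ∞ := (isMixed_iff.1 h).2

theorem IsMixed.add {ρ σ : Op I} (hρ : IsMixed ρ) (hσ : IsMixed σ) : IsMixed (ρ + σ) := by
  refine isMixed_iff.2 ⟨hρ.1.add hσ.1, ?_⟩
  rw [posTrace_add hρ.1 hσ.1]
  exact ENNReal.add_ne_top.2 ⟨hρ.posTrace_ne_top, hσ.posTrace_ne_top⟩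

theorem IsMixed.conj {ρ : Op I} (hρ : IsMixed ρ) (T : Ell2 I →L[ℂ] Ell2 J) :
    IsMixed (T ∘L ρ ∘L T.adjoint) :=
  isMixed_iff.2 ⟨hρ.1.conj_adjoint T, ((posTrace_conj_le T hρ.1).trans_lt
    (ENNReal.mul_lt_top ENNReal.ofReal_lt_top hρ.posTrace_ne_top.lt_top)).ne⟩

theorem IsMixed.sandwich {ρ : Op I} (hρ : IsMixed ρ) (K : Op I) : IsMixed (sandwich K ρ) :=
  hρ.conj K

theorem eq_zero_of_posTrace_eq_zero {P : Op I} (hP : P.IsPositive) (h : posTrace P = 0) :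
    P = 0 := by
  have := norm_le_posTrace hP
  rw [h, nonpos_iff_eq_zero, ENNReal.ofReal_eq_zero] at this
  exact norm_le_zero_iff.1 this

/-- A complete pair of Kraus operators preserves the trace. -/
theorem posTrace_kraus (K L : Op I) (h : K.adjoint ∘L K + L.adjoint ∘L L =
    ContinuousLinearMap.id ℂ (Ell2 I)) {P : Op I} (hP : P.IsPositive) :
    posTrace (sandwich K P) + posTrace (sandwich L P) = posTrace P := by
  obtain ⟨S, hS, rfl⟩ := exists_sqrt hP
  rw [sandwich, sandwich, posTrace_conj_sqrt K hS, posTrace_conj_sqrt L hS, posTrace_sq hS,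
    hsSq, hsSq, hsSq, ← ENNReal.tsum_add]
  refine tsum_congr fun i => ?_
  rw [← ENNReal.ofReal_add (by positivity) (by positivity)]
  congr 1
  set x := S (ket i)
  have h1 : (inner ℂ x ((K.adjoint ∘L K + L.adjoint ∘L L) x)) = inner ℂ x x := by rw [h]; rfl
  rw [add_apply, inner_add_right, ContinuousLinearMap.comp_apply,
    ContinuousLinearMap.comp_apply, ContinuousLinearMap.adjoint_inner_right,
    ContinuousLinearMap.adjoint_inner_right, inner_self_eq_norm_sq_to_K,
    inner_self_eq_norm_sq_to_K, inner_self_eq_norm_sq_to_K] at h1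
  exact_mod_cast h1

/-- The trace of `A ∘ ρ` for a positive operator `A`, as an element of `[0, ∞]`. -/
def pairing (A ρ : Op I) : ℝ≥0∞ := posTrace (sandwich (opSqrt A) ρ)

/-- Both traces are squared Hilbert–Schmidt norms of `√A ∘L S`. The right-hand form is free of `√A`,
which makes additivity in `A` visible. -/
theorem pairing_eq {A S : Op I} (hA : A.IsPositive) (hS : S.adjoint = S) :
    pairing A (S ∘L S) = posTrace (S ∘L A ∘L S) := by
  rw [pairing, sandwich, posTrace_conj_sqrt _ hS, ← posTrace_adjoint_comp]
  congr 1
  nth_rw 3 [← opSqrt_comp_opSqrt hA]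
  rw [ContinuousLinearMap.adjoint_comp, opSqrt_adjoint, hS]
  rfl

theorem pairing_add_left {A B ρ : Op I} (hA : A.IsPositive) (hB : B.IsPositive)
    (hρ : ρ.IsPositive) : pairing (A + B) ρ = pairing A ρ + pairing B ρ := by
  obtain ⟨S, hS, rfl⟩ := exists_sqrt hρ
  rw [pairing_eq hA hS, pairing_eq hB hS, pairing_eq (hA.add hB) hS, ← posTrace_add]
  · rw [ContinuousLinearMap.add_comp, ContinuousLinearMap.comp_add]
  · simpa [hS] using hA.conj_adjoint S
  · simpa [hS] using hB.conj_adjoint S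

theorem pairing_add_right {A ρ σ : Op I} (hρ : ρ.IsPositive) (hσ : σ.IsPositive) :
    pairing A (ρ + σ) = pairing A ρ + pairing A σ := by
  rw [pairing, sandwich_add, posTrace_add (sandwich_isPositive hρ _) (sandwich_isPositive hσ _)]
  rfl

theorem pairing_conj {A ρ : Op I} (hA : A.IsPositive) (hρ : ρ.IsPositive) (K : Op I) :
    pairing (K.adjoint ∘L A ∘L K) ρ = pairing A (sandwich K ρ) := by
  obtain ⟨S, hS, rfl⟩ := exists_sqrt hρ
  rw [pairing_eq (hA.adjoint_conj K) hS]
  have h1 : S ∘L (K.adjoint ∘L A ∘L K) ∘L S =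
      (opSqrt A ∘L K ∘L S).adjoint ∘L (opSqrt A ∘L K ∘L S) := by
    nth_rw 1 [← opSqrt_comp_opSqrt hA]
    rw [ContinuousLinearMap.adjoint_comp, ContinuousLinearMap.adjoint_comp, opSqrt_adjoint, hS]
    rfl
  rw [h1, posTrace_adjoint_comp, pairing, ← posTrace_comp_adjoint]
  congr 1
  rw [ContinuousLinearMap.adjoint_comp, ContinuousLinearMap.adjoint_comp, hS]
  rfl

theorem pairing_le (A : Op I) {ρ : Op I} (hρ : ρ.IsPositive) :
    pairing A ρ ≤ ENNReal.ofReal (‖opSqrt A‖ ^ 2) * posTrace ρ :=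
  posTrace_conj_le _ hρ

theorem pairing_ne_top (A : Op I) {ρ : Op I} (hρ : IsMixed ρ) : pairing A ρ ≠ ∞ :=
  (hρ.sandwich _).posTrace_ne_top

theorem trace_eq_posTrace {ρ : Op I} (hρ : ρ.IsPositive) : trace ρ = (posTrace ρ).toReal := by
  rw [posTrace, ENNReal.tsum_toReal_eq (fun _ => ENNReal.ofReal_ne_top), Complex.ofReal_tsum, trace]
  refine tsum_congr fun i => ?_
  rw [ENNReal.toReal_ofReal (re_inner_nonneg hρ _)]
  have := hρ.inner_nonneg_right (ket i)
  exact Complex.ext rfl (Complex.nonneg_iff.1 this).2.symm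

/-- For `ρ = S ∘L S` the operator `S` is Hilbert–Schmidt, hence so is `S ∘L A`, and cyclicity moves
one factor `S` across: `tr A S S = tr S A S`. -/
theorem trace_comp {A ρ : Op I} (hA : A.IsPositive) (hρ : IsMixed ρ) :
    trace (A ∘L ρ) = (pairing A ρ).toReal := by
  obtain ⟨hp, ht⟩ := isMixed_iff.1 hρ
  obtain ⟨S, hS, rfl⟩ := exists_sqrt hp
  rw [pairing_eq hA hS, ← trace_eq_posTrace (by simpa [hS] using hA.conj_adjoint S)]
  have hs : hsSq S ≠ ∞ := by
    rwa [← posTrace_adjoint_comp, hS]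
  have hsa : hsSq (S ∘L A) ≠ ∞ := by
    rw [← hsSq_adjoint, ContinuousLinearMap.adjoint_comp, hS]
    exact ((hsSq_comp_le _ _).trans_lt (ENNReal.mul_lt_top ENNReal.ofReal_lt_top hs.lt_top)).ne
  have h := tsum_inner_eq_tsum_inner_adjoint hsa hs
  simp only [trace]
  rw [ContinuousLinearMap.adjoint_comp, hS, hA.isSelfAdjoint.adjoint_eq] at h
  refine Eq.trans (tsum_congr fun i => ?_) (h.trans (tsum_congr fun i => ?_))
  · rw [ContinuousLinearMap.comp_apply, ← ContinuousLinearMap.adjoint_inner_left,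
      hA.isSelfAdjoint.adjoint_eq, ContinuousLinearMap.comp_apply,
      ← ContinuousLinearMap.adjoint_inner_left, hS]
    rfl
  · rw [ContinuousLinearMap.comp_apply S,
      ← ContinuousLinearMap.adjoint_inner_left S _ (ket i), hS]

end PosTrace

/-! ### Sums of positive operators -/

section Sums

variable {I J ι : Type*}

theorem hasSum_re_inner {f : ι → Op I} {σ : Op I} (h : HasSum f σ) (x : Ell2 I) :
    HasSum (fun k => (inner ℂ x (f k x)).re) (inner ℂ x (σ x)).re := by
  have h1 := ((ContinuousLinearMap.apply ℂ (Ell2 I) x).hasSum h).mapL (innerSL ℂ x)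
  exact h1.mapL Complex.reCLM

theorem isPositive_of_hasSum {f : ι → Op I} {σ : Op I} (h : HasSum f σ)
    (hf : ∀ k, (f k).IsPositive) : σ.IsPositive := by
  rw [← ContinuousLinearMap.nonneg_iff_isPositive]
  exact h.nonneg fun k => (ContinuousLinearMap.nonneg_iff_isPositive _).2 (hf k)

theorem posTrace_hasSum {f : ι → Op I} {σ : Op I} (h : HasSum f σ)
    (hf : ∀ k, (f k).IsPositive) : posTrace σ = ∑' k, posTrace (f k) := by
  simp only [posTrace]
  rw [ENNReal.tsum_comm]
  refine tsum_congr fun i => ?_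
  rw [← (hasSum_re_inner h (ket i)).tsum_eq]
  exact ENNReal.ofReal_tsum_of_nonneg (fun k => re_inner_nonneg (hf k) _)
    (hasSum_re_inner h (ket i)).summable

/-- The operator norm is at most the trace, so the series converges absolutely. -/
theorem summable_of_posTrace {f : ι → Op I} (hf : ∀ k, (f k).IsPositive)
    (h : ∑' k, posTrace (f k) ≠ ∞) : Summable f := by
  refine Summable.of_norm_bounded (ENNReal.summable_toReal h) fun k => ?_
  have := norm_le_posTrace (hf k)
  exact (ENNReal.ofReal_le_iff_le_toReal (ENNReal.ne_top_of_tsum_ne_top h k)).1 this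

theorem hasSum_of_traceHasSum {f : ι → Op I} {σ : Op I} (h : TraceHasSum f σ) : HasSum f σ := by
  rw [HasSum, SummationFilter.unconditional_filter, tendsto_iff_norm_sub_tendsto_zero]
  have h1 : Filter.Tendsto (fun F : Finset ι => ENNReal.ofReal ‖σ - ∑ k ∈ F, f k‖)
      Filter.atTop (𝓝 0) :=
    tendsto_of_tendsto_of_tendsto_of_le_of_le tendsto_const_nhds h (fun _ => zero_le)
      fun F => norm_le_traceNorm _
  have h2 := (ENNReal.tendsto_toReal ENNReal.zero_ne_top).comp h1
  refine h2.congr fun F => ?_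
  simp [norm_sub_rev]

/-- The remainder is the sum of the terms outside `F`, hence positive; its trace norm is therefore
its trace, the tail of a convergent series. For positive terms with a trace-class sum, operator-norm
convergence thus suffices. -/
theorem traceHasSum_of_hasSum {f : ι → Op I} {σ : Op I} (h : HasSum f σ)
    (hf : ∀ k, (f k).IsPositive) (hσ : posTrace σ ≠ ∞) : TraceHasSum f σ := by
  rw [posTrace_hasSum h hf] at hσ
  refine (ENNReal.tendsto_tsum_compl_atTop_zero hσ).congr fun F => ?_
  have h1 : HasSum (fun k : {k // k ∉ F} => f k) (σ - ∑ k ∈ F, f k) :=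
    (Finset.hasSum_compl_iff F).2 (by simpa using h)
  rw [traceNorm_of_isPositive (isPositive_of_hasSum h1 fun k => hf k),
    posTrace_hasSum h1 fun k => hf k]

/-- The choice made by `traceSum` is harmless: trace-norm convergence implies operator-norm
convergence, whose limit is unique. -/
theorem traceSum_eq {f : ι → Op I} {σ : Op I} (h : HasSum f σ)
    (hf : ∀ k, (f k).IsPositive) (hσ : posTrace σ ≠ ∞) : traceSum f = σ := by
  have hex : ∃ σ, TraceHasSum f σ := ⟨σ, traceHasSum_of_hasSum h hf hσ⟩
  rw [traceSum, dif_pos hex]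
  exact (hasSum_of_traceHasSum hex.choose_spec).unique h

theorem hasSum_traceSum {f : ι → Op I} (hf : ∀ k, (f k).IsPositive)
    (h : ∑' k, posTrace (f k) ≠ ∞) : HasSum f (traceSum f) ∧ IsMixed (traceSum f) := by
  obtain ⟨σ, hσ⟩ := summable_of_posTrace hf h
  have ht : posTrace σ ≠ ∞ := by rwa [posTrace_hasSum hσ hf]
  rw [traceSum_eq hσ hf ht]
  exact ⟨hσ, isMixed_iff.2 ⟨isPositive_of_hasSum hσ hf, ht⟩⟩

theorem hasSum_conj {f : ι → Op I} {σ : Op I} (h : HasSum f σ) (T : Ell2 I →L[ℂ] Ell2 J) :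
    HasSum (fun k => T ∘L f k ∘L T.adjoint) (T ∘L σ ∘L T.adjoint) :=
  (h.mapL ((ContinuousLinearMap.compL ℂ _ _ _).flip T.adjoint)).mapL
    (ContinuousLinearMap.compL ℂ _ _ _ T)

end Sums


/-! ### Renaming the basis -/

section Reindex

variable {I J K : Type*}

theorem reindex_ket (e : I ≃ J) (i : I) : reindex e (ket i) = ket (e i) := by
  classical
  ext j
  change ket i (e.symm j) = ket (e i) j
  rw [← inner_ket_left, ← inner_ket_left, inner_ket_left, inner_ket_left, ket, ket,
    lp.single_apply, lp.single_apply, Pi.single_apply, Pi.single_apply]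
  simp [Equiv.symm_apply_eq]

theorem adjoint_reindex (e : I ≃ J) :
    ((reindex e : Ell2 I ≃ₗᵢ[ℂ] Ell2 J) : Ell2 I →L[ℂ] Ell2 J).adjoint = (reindex e).symm := by
  symm
  rw [ContinuousLinearMap.eq_adjoint_iff]
  intro x y
  rw [← LinearIsometryEquiv.inner_map_map (reindex e)]
  simp

theorem Op.reindex_eq_conj (e : I ≃ J) (A : Op I) :
    Op.reindex e A = ((QRHL.reindex e : Ell2 I ≃ₗᵢ[ℂ] Ell2 J) : Ell2 I →L[ℂ] Ell2 J) ∘L A ∘L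
      ((QRHL.reindex e : Ell2 I ≃ₗᵢ[ℂ] Ell2 J) : Ell2 I →L[ℂ] Ell2 J).adjoint := by
  rw [adjoint_reindex]
  rfl

theorem Op.reindex_apply (e : I ≃ J) (A : Op I) (x : Ell2 J) :
    Op.reindex e A x = QRHL.reindex e (A ((QRHL.reindex e).symm x)) := rfl

theorem Op.reindex_comp (e : I ≃ J) (A B : Op I) :
    Op.reindex e (A ∘L B) = Op.reindex e A ∘L Op.reindex e B := by
  ext1 x
  simp [Op.reindex_apply]

theorem Op.reindex_add (e : I ≃ J) (A B : Op I) :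
    Op.reindex e (A + B) = Op.reindex e A + Op.reindex e B := by
  ext1 x
  simp [Op.reindex_apply]

theorem Op.reindex_id (e : I ≃ J) :
    Op.reindex e (ContinuousLinearMap.id ℂ (Ell2 I)) = ContinuousLinearMap.id ℂ (Ell2 J) := by
  ext1 x
  simp [Op.reindex_apply]

theorem Op.reindex_adjoint (e : I ≃ J) (A : Op I) :
    (Op.reindex e A).adjoint = Op.reindex e A.adjoint := by
  rw [Op.reindex_eq_conj, Op.reindex_eq_conj, ContinuousLinearMap.adjoint_comp,
    ContinuousLinearMap.adjoint_comp, ContinuousLinearMap.adjoint_adjoint]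
  rfl

theorem Op.reindex_sandwich (e : I ≃ J) (A B : Op I) :
    Op.reindex e (sandwich A B) = sandwich (Op.reindex e A) (Op.reindex e B) := by
  rw [sandwich, sandwich, Op.reindex_comp, Op.reindex_comp, Op.reindex_adjoint]

theorem Op.reindex_isPositive (e : I ≃ J) {A : Op I} (hA : A.IsPositive) :
    (Op.reindex e A).IsPositive := by
  rw [Op.reindex_eq_conj]
  exact hA.conj_adjoint _

theorem posTrace_reindex (e : I ≃ J) (A : Op I) : posTrace (Op.reindex e A) = posTrace A := by
  rw [posTrace, posTrace, ← e.tsum_eq]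
  refine tsum_congr fun i => ?_
  rw [Op.reindex_apply, ← reindex_ket, LinearIsometryEquiv.symm_apply_apply,
    LinearIsometryEquiv.inner_map_map]

theorem IsMixed.reindex {A : Op I} (hA : IsMixed A) (e : I ≃ J) : IsMixed (Op.reindex e A) :=
  isMixed_iff.2 ⟨Op.reindex_isPositive e hA.1, by
    rw [posTrace_reindex]; exact hA.posTrace_ne_top⟩

theorem hasSum_reindex {ι : Type*} {f : ι → Op I} {σ : Op I} (h : HasSum f σ) (e : I ≃ J) :
    HasSum (fun k => Op.reindex e (f k)) (Op.reindex e σ) := by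
  simp only [Op.reindex_eq_conj]
  exact hasSum_conj h _

end Reindex

/-! ### Tensor products -/

section Tensor

variable {I J : Type*}

theorem ext_slice {Φ Ψ : Ell2 (I × J)} (h : ∀ j, slice j Φ = slice j Ψ) : Φ = Ψ := by
  ext p
  exact congrArg (fun f : Ell2 I => f p.1) (h p.2)

theorem hasSum_inner_slice (Φ Ψ : Ell2 (I × J)) :
    HasSum (fun j => inner ℂ (slice j Φ) (slice j Ψ)) (inner ℂ Φ Ψ) := by
  have h := (Equiv.prodComm J I).hasSum_iff (f := fun p => inner ℂ (Φ p) (Ψ p)) |>.2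
    (lp.hasSum_inner Φ Ψ)
  exact h.prod_fiberwise fun j => lp.hasSum_inner (slice j Φ) (slice j Ψ)

theorem slice_ampL (A : Op I) (j : J) (Ψ : Ell2 (I × J)) :
    slice j (ampL A Ψ) = A (slice j Ψ) := rfl

theorem ampL_comp (A B : Op I) : (ampL (A ∘L B) : Op (I × J)) = ampL A ∘L ampL B := rfl

theorem ampL_add (A B : Op I) : (ampL (A + B) : Op (I × J)) = ampL A + ampL B := rfl

theorem ampL_id : ampL (ContinuousLinearMap.id ℂ (Ell2 I)) =
    ContinuousLinearMap.id ℂ (Ell2 (I × J)) := rfl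

theorem ampL_adjoint (A : Op I) : (ampL A : Op (I × J)).adjoint = ampL A.adjoint := by
  symm
  rw [ContinuousLinearMap.eq_adjoint_iff]
  intro Φ Ψ
  refine (hasSum_inner_slice _ _).unique ?_
  convert hasSum_inner_slice Φ (ampL A Ψ) using 2 with j
  rw [slice_ampL, slice_ampL, ContinuousLinearMap.adjoint_inner_left]

theorem ampR_adjoint (B : Op J) : (ampR B : Op (I × J)).adjoint = ampR B.adjoint := by
  rw [ampR, ampR, Op.reindex_adjoint, ampL_adjoint]

theorem summable_tens (x : Ell2 I) (y : Ell2 J) : Summable fun p : I × J => ‖x p.1 * y p.2‖ ^ 2 := by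
  simp only [norm_mul, mul_pow]
  exact (hasSum_sq x).summable.mul_of_nonneg (hasSum_sq y).summable
    (fun _ => by positivity) (fun _ => by positivity)

/-- The tensor product of two vectors. -/
def tens (x : Ell2 I) (y : Ell2 J) : Ell2 (I × J) :=
  ⟨fun p => x p.1 * y p.2, (memLp2_iff _).2 (summable_tens x y)⟩

theorem slice_tens (x : Ell2 I) (y : Ell2 J) (j : J) : slice j (tens x y) = y j • x := by
  ext i
  exact mul_comm _ _

theorem inner_tens (x x' : Ell2 I) (y y' : Ell2 J) :
    inner ℂ (tens x y) (tens x' y') = inner ℂ x x' * inner ℂ y y' := by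
  refine (hasSum_inner_slice _ _).unique ?_
  refine ((lp.hasSum_inner y y').mul_left (inner ℂ x x')).congr_fun fun j => ?_
  rw [slice_tens, slice_tens, inner_smul_left, inner_smul_right, RCLike.inner_apply]
  ring

theorem norm_tens (x : Ell2 I) (y : Ell2 J) : ‖tens x y‖ = ‖x‖ * ‖y‖ := by
  have h := inner_tens x x y y
  simp only [inner_self_eq_norm_sq_to_K] at h
  have h' : ‖tens x y‖ ^ 2 = (‖x‖ * ‖y‖) ^ 2 := by
    rw [mul_pow]
    exact_mod_cast h
  exact (sq_eq_sq₀ (norm_nonneg _) (by positivity)).1 h'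

/-- The operator `y ↦ x ⊗ y`. -/
def tensL (x : Ell2 I) : Ell2 J →L[ℂ] Ell2 (I × J) :=
  LinearMap.mkContinuous
    { toFun := tens x
      map_add' := fun _ _ => by ext p; exact mul_add _ _ _
      map_smul' := fun _ _ => by ext p; exact mul_left_comm _ _ _ } ‖x‖
    fun y => (norm_tens x y).le

theorem tensL_apply (x : Ell2 I) (y : Ell2 J) : tensL x y = tens x y := rfl

theorem tens_ket (i : I) (j : J) : tens (ket i) (ket j) = ket (i, j) := by
  classical
  ext p
  change ket i p.1 * ket j p.2 = _
  simp only [ket, lp.single_apply, Pi.single_apply, Prod.ext_iff]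
  by_cases h1 : p.1 = i <;> by_cases h2 : p.2 = j <;> simp [h1, h2]

theorem reindex_prodComm_tens (x : Ell2 I) (y : Ell2 J) :
    reindex (Equiv.prodComm I J) (tens x y) = tens y x := by
  ext p
  exact mul_comm _ _

theorem ampL_tens (A : Op I) (x : Ell2 I) (y : Ell2 J) : ampL A (tens x y) = tens (A x) y := by
  refine ext_slice fun j => ?_
  rw [slice_ampL, slice_tens, slice_tens, map_smul]

theorem ampR_tens (B : Op J) (x : Ell2 I) (y : Ell2 J) : ampR B (tens x y) = tens x (B y) := by
  change reindex (Equiv.prodComm J I) (ampL B (reindex (Equiv.prodComm I J) (tens x y))) = _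
  rw [reindex_prodComm_tens, ampL_tens, reindex_prodComm_tens]

theorem tensor_tens (A : Op I) (B : Op J) (x : Ell2 I) (y : Ell2 J) :
    tensor A B (tens x y) = tens (A x) (B y) := by
  rw [tensor, ContinuousLinearMap.comp_apply, ampR_tens, ampL_tens]

/-- The basis vectors of the product are themselves product vectors. -/
theorem ext_tens {E : Type*} [NormedAddCommGroup E] [NormedSpace ℂ E]
    {S T : Ell2 (I × J) →L[ℂ] E} (h : ∀ x y, S (tens x y) = T (tens x y)) : S = T :=
  ext_ket fun p => by simpa only [tens_ket] using h (ket p.1) (ket p.2)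

theorem tensor_comp (A A' : Op I) (B B' : Op J) :
    tensor (A ∘L A') (B ∘L B') = tensor A B ∘L tensor A' B' :=
  ext_tens fun x y => by simp only [ContinuousLinearMap.comp_apply, tensor_tens]

theorem tensor_adjoint (A : Op I) (B : Op J) :
    (tensor A B).adjoint = tensor A.adjoint B.adjoint := by
  rw [tensor, ContinuousLinearMap.adjoint_comp, ampL_adjoint, ampR_adjoint]
  exact ext_tens fun x y => by
    rw [tensor_tens, ContinuousLinearMap.comp_apply, ampL_tens, ampR_tens]

/-- Operators on different factors commute, so either measurement may be performed first; each
marginal needs its own order. -/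
theorem ampR_comp_ampL (A : Op I) (B : Op J) : ampR B ∘L ampL A = tensor A B :=
  ext_tens fun x y => by
    rw [tensor_tens, ContinuousLinearMap.comp_apply, ampL_tens, ampR_tens]

theorem sandwich_tensor (A : Op I) (B : Op J) (σ : Op I) (τ : Op J) :
    sandwich (tensor A B) (tensor σ τ) = tensor (sandwich A σ) (sandwich B τ) := by
  rw [sandwich, sandwich, sandwich, tensor_comp, tensor_comp, tensor_adjoint]

theorem tens_add (x : Ell2 I) (y y' : Ell2 J) : tens x (y + y') = tens x y + tens x y' :=
  (tensL x).map_add y y'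

theorem tensor_add_right (A : Op I) (B B' : Op J) :
    tensor A (B + B') = tensor A B + tensor A B' :=
  ext_tens fun x y => by
    simp only [tensor_tens, add_apply, tens_add]

theorem hsSq_tensor (A : Op I) (B : Op J) : hsSq (tensor A B) = hsSq A * hsSq B := by
  rw [hsSq, hsSq, ← ENNReal.tsum_mul_right, ENNReal.tsum_prod
    (f := fun i j => ENNReal.ofReal (‖tensor A B (ket (i, j))‖ ^ 2))]
  refine tsum_congr fun i => ?_
  rw [hsSq, ← ENNReal.tsum_mul_left]
  refine tsum_congr fun j => ?_
  rw [← tens_ket, tensor_tens, norm_tens, mul_pow, ENNReal.ofReal_mul (by positivity)]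

theorem tensor_isPositive {σ : Op I} {τ : Op J} (hσ : σ.IsPositive) (hτ : τ.IsPositive) :
    (tensor σ τ).IsPositive ∧ posTrace (tensor σ τ) = posTrace σ * posTrace τ := by
  obtain ⟨S, hS, rfl⟩ := exists_sqrt hσ
  obtain ⟨R, hR, rfl⟩ := exists_sqrt hτ
  have hT : (tensor S R).adjoint = tensor S R := by rw [tensor_adjoint, hS, hR]
  rw [tensor_comp, posTrace_sq hT, posTrace_sq hS, posTrace_sq hR, hsSq_tensor]
  refine ⟨?_, rfl⟩
  have := ContinuousLinearMap.isPositive_adjoint_comp_self (tensor S R)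
  rwa [hT] at this

theorem IsMixed.tensor {σ : Op I} {τ : Op J} (hσ : IsMixed σ) (hτ : IsMixed τ) :
    IsMixed (tensor σ τ) := by
  obtain ⟨h1, h2⟩ := tensor_isPositive hσ.1 hτ.1
  exact isMixed_iff.2 ⟨h1, h2 ▸ ENNReal.mul_ne_top hσ.posTrace_ne_top hτ.posTrace_ne_top⟩

theorem reindex_prodComm_tensor (σ : Op I) (τ : Op J) :
    Op.reindex (Equiv.prodComm I J) (tensor σ τ) = tensor τ σ :=
  ext_tens fun x y => by
    change reindex (Equiv.prodComm I J) (tensor σ τ (reindex (Equiv.prodComm J I) (tens x y))) = _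
    rw [reindex_prodComm_tens, tensor_tens, reindex_prodComm_tens, tensor_tens]

end Tensor

/-! ### Partial traces -/

section PartialTrace

variable {I J : Type*}

theorem adjoint_slice_apply (j : J) (x : Ell2 I) : (slice j).adjoint x = tens x (ket j) := by
  refine ext_inner_left ℂ fun Ψ => ?_
  rw [ContinuousLinearMap.adjoint_inner_right]
  refine Eq.symm ((hasSum_inner_slice _ _).unique ?_)
  classical
  convert hasSum_ite_eq j (inner ℂ (slice j Ψ) x) using 2 with k
  rw [slice_tens, inner_smul_right, ket, lp.single_apply, Pi.single_apply]
  split_ifs with h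
  · rw [h, one_mul]
  · exact zero_mul _

theorem posTrace_conj_tensL (ρ : Op (I × J)) (x : Ell2 I) :
    posTrace ((tensL x).adjoint ∘L ρ ∘L tensL x) =
      ∑' j : J, ENNReal.ofReal (inner ℂ x ((slice j ∘L ρ ∘L (slice j).adjoint) x)).re := by
  refine tsum_congr fun j => ?_
  rw [ContinuousLinearMap.comp_apply, ContinuousLinearMap.adjoint_inner_right,
    ContinuousLinearMap.comp_apply, ContinuousLinearMap.comp_apply (slice j),
    ← ContinuousLinearMap.adjoint_inner_left (slice j), ContinuousLinearMap.comp_apply,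
    adjoint_slice_apply, tensL_apply]

theorem tsum_posTrace_slice (ρ : Op (I × J)) :
    ∑' j : J, posTrace (slice j ∘L ρ ∘L (slice j).adjoint) = posTrace ρ := by
  simp only [posTrace]
  rw [ENNReal.tsum_comm, ENNReal.tsum_prod
    (f := fun i j => ENNReal.ofReal (inner ℂ (ket (i, j)) (ρ (ket (i, j)))).re)]
  refine tsum_congr fun i => tsum_congr fun j => ?_
  rw [ContinuousLinearMap.comp_apply, ← ContinuousLinearMap.adjoint_inner_left,
    ContinuousLinearMap.comp_apply, adjoint_slice_apply, tens_ket]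

theorem hasSum_slice_ptraceR {ρ : Op (I × J)} (hρ : IsMixed ρ) :
    HasSum (fun j : J => slice j ∘L ρ ∘L (slice j).adjoint) (ptraceR ρ) ∧ IsMixed (ptraceR ρ) :=
  hasSum_traceSum (fun j => hρ.1.conj_adjoint (slice j))
    (by rw [tsum_posTrace_slice]; exact hρ.posTrace_ne_top)

theorem IsMixed.ptraceR {ρ : Op (I × J)} (hρ : IsMixed ρ) : IsMixed (ptraceR ρ) :=
  (hasSum_slice_ptraceR hρ).2

theorem posTrace_ptraceR {ρ : Op (I × J)} (hρ : IsMixed ρ) :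
    posTrace (ptraceR ρ) = posTrace ρ := by
  rw [posTrace_hasSum (hasSum_slice_ptraceR hρ).1 fun j => hρ.1.conj_adjoint (slice j),
    tsum_posTrace_slice]

/-- The quadratic form of a positive operator, as an element of `[0, ∞]`. -/
def quad (P : Op I) (x : Ell2 I) : ℝ≥0∞ := ENNReal.ofReal (inner ℂ x (P x)).re

/-- Complex polarization. Identities between marginals thereby reduce to identities between traces
in `[0, ∞]`. -/
theorem eq_of_quad {P Q : Op I} (hP : P.IsPositive) (hQ : Q.IsPositive)
    (h : ∀ x, quad P x = quad Q x) : P = Q := by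
  refine ext_inner_self fun x => ?_
  have h1 := (ENNReal.ofReal_eq_ofReal_iff (re_inner_nonneg hP x) (re_inner_nonneg hQ x)).1 (h x)
  exact Complex.ext h1 ((Complex.nonneg_iff.1 (hP.inner_nonneg_right x)).2.symm.trans
    (Complex.nonneg_iff.1 (hQ.inner_nonneg_right x)).2)

theorem quad_add {P Q : Op I} (hP : P.IsPositive) (hQ : Q.IsPositive) (x : Ell2 I) :
    quad (P + Q) x = quad P x + quad Q x := by
  rw [quad, quad, quad, ← ENNReal.ofReal_add (re_inner_nonneg hP _) (re_inner_nonneg hQ _),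
    ← Complex.add_re, ← inner_add_right]
  rfl

theorem quad_hasSum {ι : Type*} {f : ι → Op I} {σ : Op I} (h : HasSum f σ)
    (hf : ∀ k, (f k).IsPositive) (x : Ell2 I) : quad σ x = ∑' k, quad (f k) x := by
  rw [quad, ← (hasSum_re_inner h x).tsum_eq]
  exact ENNReal.ofReal_tsum_of_nonneg (fun k => re_inner_nonneg (hf k) _)
    (hasSum_re_inner h x).summable

/-- The compression of `ρ` by `y ↦ x ⊗ y` is an operator on the second factor whose diagonal entries
are the terms of the partial trace tested at `x`. -/
theorem quad_ptraceR {ρ : Op (I × J)} (hρ : IsMixed ρ) (x : Ell2 I) :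
    quad (ptraceR ρ) x = posTrace ((tensL x).adjoint ∘L ρ ∘L tensL x) := by
  rw [posTrace_conj_tensL, quad_hasSum (hasSum_slice_ptraceR hρ).1 fun j =>
    hρ.1.conj_adjoint (slice j)]
  rfl

theorem ptraceR_add {ρ σ : Op (I × J)} (hρ : IsMixed ρ) (hσ : IsMixed σ) :
    ptraceR (ρ + σ) = ptraceR ρ + ptraceR σ := by
  refine eq_of_quad (hρ.add hσ).ptraceR.1 (hρ.ptraceR.add hσ.ptraceR).1 fun x => ?_
  rw [quad_add hρ.ptraceR.1 hσ.ptraceR.1, quad_ptraceR (hρ.add hσ), quad_ptraceR hρ,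
    quad_ptraceR hσ, ← posTrace_add (hρ.1.adjoint_conj _) (hσ.1.adjoint_conj _)]
  simp only [ContinuousLinearMap.add_comp, ContinuousLinearMap.comp_add]

/-- Partial traces preserve the trace, which gives summability; the limit is then identified through
its quadratic form. -/
theorem hasSum_ptraceR {ι : Type*} {f : ι → Op (I × J)} {ρ : Op (I × J)} (h : HasSum f ρ)
    (hf : ∀ k, IsMixed (f k)) (hρ : IsMixed ρ) :
    HasSum (fun k => ptraceR (f k)) (ptraceR ρ) := by
  have hpos : ∀ k, (ptraceR (f k)).IsPositive := fun k => (hf k).ptraceR.1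
  obtain ⟨τ, hτ⟩ := summable_of_posTrace hpos (by
    simp only [posTrace_ptraceR (hf _)]
    rw [← posTrace_hasSum h fun k => (hf k).1]
    exact hρ.posTrace_ne_top)
  convert hτ using 1
  refine eq_of_quad hρ.ptraceR.1 (isPositive_of_hasSum hτ hpos) fun x => ?_
  have h1 := hasSum_conj h (tensL x).adjoint
  rw [ContinuousLinearMap.adjoint_adjoint] at h1
  rw [quad_hasSum hτ hpos, quad_ptraceR hρ, posTrace_hasSum h1 fun k => (hf k).1.adjoint_conj _]
  exact tsum_congr fun k => (quad_ptraceR (hf k) x).symm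

theorem ptraceR_tensor {σ : Op I} {τ : Op J} (hσ : IsMixed σ) (hτ : IsMixed τ) :
    ptraceR (tensor σ τ) = ((posTrace τ).toReal : ℂ) • σ := by
  have hp : (((posTrace τ).toReal : ℂ) • σ).IsPositive := by
    refine hσ.1.smul_of_nonneg ?_
    exact_mod_cast ENNReal.toReal_nonneg
  refine eq_of_quad (hσ.tensor hτ).ptraceR.1 hp fun x => ?_
  rw [quad_ptraceR (hσ.tensor hτ), quad, smul_apply, inner_smul_right, Complex.re_ofReal_mul,
    ENNReal.ofReal_mul ENNReal.toReal_nonneg, ENNReal.ofReal_toReal hτ.posTrace_ne_top, posTrace,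
    posTrace, ← ENNReal.tsum_mul_right]
  refine tsum_congr fun j => ?_
  rw [ContinuousLinearMap.comp_apply, ContinuousLinearMap.adjoint_inner_right,
    ContinuousLinearMap.comp_apply, tensL_apply, tensor_tens, inner_tens,
    ← ENNReal.ofReal_mul (re_inner_nonneg hτ.1 _), Complex.mul_re,
    ← (Complex.nonneg_iff.1 (hσ.1.inner_nonneg_right x)).2, zero_mul, sub_zero, mul_comm]

theorem ptraceR_sandwich_ampL {ρ : Op (I × J)} (hρ : IsMixed ρ) (K : Op I) :
    ptraceR (sandwich (ampL K) ρ) = sandwich K (ptraceR ρ) := by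
  refine (hasSum_slice_ptraceR (hρ.sandwich _)).1.unique ?_
  have h := hasSum_conj (hasSum_slice_ptraceR hρ).1 K
  refine h.congr_fun fun j => ?_
  have h1 : slice j ∘L ampL K = K ∘L (slice j : Ell2 (I × J) →L[ℂ] Ell2 I) := rfl
  have h2 := congrArg ContinuousLinearMap.adjoint h1
  rw [ContinuousLinearMap.adjoint_comp, ContinuousLinearMap.adjoint_comp] at h2
  change slice j ∘L (ampL K ∘L ρ ∘L (ampL K).adjoint) ∘L (slice j).adjoint =
    (K ∘L slice j) ∘L ρ ∘L ((slice j).adjoint ∘L K.adjoint)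
  rw [← h1, ← h2]
  rfl

/-- A measurement on the second factor does not change the first marginal. -/
theorem ptraceR_sandwich_ampR_add {ρ : Op (I × J)} (hρ : IsMixed ρ) (K L : Op J)
    (h : K.adjoint ∘L K + L.adjoint ∘L L = ContinuousLinearMap.id ℂ (Ell2 J)) :
    ptraceR (sandwich (ampR K) ρ) + ptraceR (sandwich (ampR L) ρ) = ptraceR ρ := by
  have hK := hρ.sandwich (ampR K)
  have hL := hρ.sandwich (ampR L)
  refine eq_of_quad (hK.ptraceR.add hL.ptraceR).1 hρ.ptraceR.1 fun x => ?_
  -- Compression by `x` on the first factor commutes with an operation on the second, so the claim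
  -- reduces to trace preservation by a complete Kraus pair.
  have key : ∀ B : Op J, (tensL x).adjoint ∘L sandwich (ampR B) ρ ∘L tensL x =
      sandwich B ((tensL x).adjoint ∘L ρ ∘L tensL x) := fun B => by
    have h1 : (ampR B).adjoint ∘L tensL x = tensL x ∘L B.adjoint := by
      ext1 y
      rw [ampR_adjoint]
      exact ampR_tens _ _ _
    have h2 := congrArg ContinuousLinearMap.adjoint h1
    rw [ContinuousLinearMap.adjoint_comp, ContinuousLinearMap.adjoint_comp,
      ContinuousLinearMap.adjoint_adjoint, ContinuousLinearMap.adjoint_adjoint] at h2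
    change ((tensL x).adjoint ∘L ampR B) ∘L ρ ∘L ((ampR B).adjoint ∘L tensL x) = _
    rw [h1, h2]
    rfl
  rw [quad_add hK.ptraceR.1 hL.ptraceR.1, quad_ptraceR hK, quad_ptraceR hL, quad_ptraceR hρ,
    key, key, posTrace_kraus K L h (hρ.1.adjoint_conj _)]

theorem IsMixed.ptraceL {ρ : Op (I × J)} (hρ : IsMixed ρ) : IsMixed (ptraceL ρ) :=
  (hρ.reindex _).ptraceR

theorem posTrace_ptraceL {ρ : Op (I × J)} (hρ : IsMixed ρ) :
    posTrace (ptraceL ρ) = posTrace ρ := by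
  rw [ptraceL, posTrace_ptraceR (hρ.reindex _), posTrace_reindex]

theorem ptraceL_add {ρ σ : Op (I × J)} (hρ : IsMixed ρ) (hσ : IsMixed σ) :
    ptraceL (ρ + σ) = ptraceL ρ + ptraceL σ := by
  rw [ptraceL, Op.reindex_add, ptraceR_add (hρ.reindex _) (hσ.reindex _)]
  rfl

theorem hasSum_ptraceL {ι : Type*} {f : ι → Op (I × J)} {ρ : Op (I × J)} (h : HasSum f ρ)
    (hf : ∀ k, IsMixed (f k)) (hρ : IsMixed ρ) :
    HasSum (fun k => ptraceL (f k)) (ptraceL ρ) :=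
  hasSum_ptraceR (hasSum_reindex h _) (fun k => (hf k).reindex _) (hρ.reindex _)

theorem ptraceL_tensor {σ : Op I} {τ : Op J} (hσ : IsMixed σ) (hτ : IsMixed τ) :
    ptraceL (tensor σ τ) = ((posTrace σ).toReal : ℂ) • τ := by
  rw [ptraceL, reindex_prodComm_tensor, ptraceR_tensor hτ hσ]

theorem ptraceL_sandwich_ampR {ρ : Op (I × J)} (hρ : IsMixed ρ) (K : Op J) :
    ptraceL (sandwich (ampR K) ρ) = sandwich K (ptraceL ρ) := by
  rw [ptraceL, Op.reindex_sandwich]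
  exact ptraceR_sandwich_ampL (hρ.reindex _) K

theorem ptraceL_sandwich_ampL_add {ρ : Op (I × J)} (hρ : IsMixed ρ) (K L : Op I)
    (h : K.adjoint ∘L K + L.adjoint ∘L L = ContinuousLinearMap.id ℂ (Ell2 I)) :
    ptraceL (sandwich (ampL K) ρ) + ptraceL (sandwich (ampL L) ρ) = ptraceL ρ := by
  rw [ptraceL, ptraceL, Op.reindex_sandwich, Op.reindex_sandwich]
  exact ptraceR_sandwich_ampR_add (hρ.reindex _) K L h

end PartialTrace


/-! ### Programs as trace-nonincreasing additive maps -/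

section Order

variable {I ι : Type*}

/-- `σ - ρ` is a mixed state. -/
def MixedLE (ρ σ : Op I) : Prop := ∃ R, IsMixed R ∧ ρ + R = σ

theorem MixedLE.trans {ρ σ τ : Op I} (h : MixedLE ρ σ) (h' : MixedLE σ τ) : MixedLE ρ τ := by
  obtain ⟨R, hR, rfl⟩ := h
  obtain ⟨Q, hQ, rfl⟩ := h'
  exact ⟨R + Q, hR.add hQ, (add_assoc _ _ _).symm⟩

theorem isMixed_zero : IsMixed (0 : Op I) :=
  isMixed_iff.2 ⟨ContinuousLinearMap.isPositive_zero, by simp [posTrace]⟩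

theorem MixedLE.refl (ρ : Op I) : MixedLE ρ ρ := ⟨0, isMixed_zero, add_zero _⟩

theorem MixedLE.posTrace_le {ρ σ : Op I} (h : MixedLE ρ σ) (hρ : ρ.IsPositive) :
    posTrace ρ ≤ posTrace σ := by
  obtain ⟨R, hR, rfl⟩ := h
  rw [posTrace_add hρ hR.1]
  exact le_self_add

theorem MixedLE.hasSum {f g : ι → Op I} {σ τ : Op I} (h : ∀ k, MixedLE (f k) (g k))
    (hf : HasSum f σ) (hg : HasSum g τ) (hσ : σ.IsPositive) (hτ : IsMixed τ) : MixedLE σ τ := by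
  have hd : (τ - σ).IsPositive := isPositive_of_hasSum (hg.sub hf) fun k => by
    obtain ⟨R, hR, h'⟩ := h k
    rw [← h', add_sub_cancel_left]
    exact hR.1
  refine ⟨τ - σ, isMixed_iff.2 ⟨hd, ?_⟩, by abel⟩
  have h1 : posTrace σ + posTrace (τ - σ) = posTrace τ := by
    rw [← posTrace_add hσ hd]
    congr 1
    abel
  exact ne_top_of_le_ne_top hτ.posTrace_ne_top (h1 ▸ le_add_self)

/-- An additive map on mixed states that does not increase the trace. -/
structure IsSubchannel (F : Op I → Op I) : Prop where
  isMixed : ∀ {ρ}, IsMixed ρ → IsMixed (F ρ)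
  map_add : ∀ {ρ σ}, IsMixed ρ → IsMixed σ → F (ρ + σ) = F ρ + F σ
  posTrace_le : ∀ {ρ}, IsMixed ρ → posTrace (F ρ) ≤ posTrace ρ

theorem IsSubchannel.mixedLE {F : Op I → Op I} (hF : IsSubchannel F) {ρ σ : Op I}
    (hρ : IsMixed ρ) (h : MixedLE ρ σ) : MixedLE (F ρ) (F σ) := by
  obtain ⟨R, hR, rfl⟩ := h
  exact ⟨F R, hF.isMixed hR, (hF.map_add hρ hR).symm⟩

theorem IsSubchannel.comp {F G : Op I → Op I} (hF : IsSubchannel F) (hG : IsSubchannel G) :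
    IsSubchannel fun ρ => F (G ρ) where
  isMixed h := hF.isMixed (hG.isMixed h)
  map_add h h' := by rw [hG.map_add h h', hF.map_add (hG.isMixed h) (hG.isMixed h')]
  posTrace_le h := (hF.posTrace_le (hG.isMixed h)).trans (hG.posTrace_le h)

theorem IsSubchannel.iterate {F : Op I → Op I} (hF : IsSubchannel F) (n : ℕ) :
    IsSubchannel F^[n] := by
  induction n with
  | zero => exact ⟨fun h => h, fun _ _ => rfl, fun _ => le_rfl⟩
  | succ n ih => exact ih.comp hF

end Order

/-! ### Program semantics and the trace balance of loops. -/

section Denotation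

universe u v

variable {V : Type u} {T : V → Type v}

theorem onVars_adjoint (X : Finset V) (A : Op (AssignOn T X)) :
    (onVars X A).adjoint = onVars X A.adjoint := by
  rw [onVars, onVars, Op.reindex_adjoint, ampL_adjoint]

theorem onVars_comp (X : Finset V) (A B : Op (AssignOn T X)) :
    onVars X (A ∘L B) = onVars X A ∘L onVars X B := by
  rw [onVars, ampL_comp, Op.reindex_comp]
  rfl

theorem onVars_complete (X : Finset V) (M : BinMeas (AssignOn T X)) :
    (onVars X (M.op true)).adjoint ∘L onVars X (M.op true) +
      (onVars X (M.op false)).adjoint ∘L onVars X (M.op false) =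
      ContinuousLinearMap.id ℂ (Ell2 (Assign T)) := by
  rw [onVars_adjoint, onVars_adjoint, ← onVars_comp, ← onVars_comp, onVars, onVars,
    ← Op.reindex_add, ← ampL_add, M.complete, ampL_id, Op.reindex_id]

theorem posTrace_restrict_add (X : Finset V) (M : BinMeas (AssignOn T X)) {ρ : Op (Assign T)}
    (hρ : ρ.IsPositive) :
    posTrace (restrict X M true ρ) + posTrace (restrict X M false ρ) = posTrace ρ :=
  posTrace_kraus _ _ (onVars_complete X M) hρ

theorem isSubchannel_restrict (X : Finset V) (M : BinMeas (AssignOn T X)) (t : Bool) :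
    IsSubchannel (restrict X M t) where
  isMixed h := h.sandwich _
  map_add _ _ := sandwich_add _ _ _
  posTrace_le h := by
    rw [← posTrace_restrict_add X M h.1]
    cases t
    · exact le_add_self
    · exact le_self_add

theorem isSubchannel_apply (X : Finset V) (U : Ell2 (AssignOn T X) →ₗᵢ[ℂ] Ell2 (AssignOn T X)) :
    IsSubchannel (Prog.apply X U).denot where
  isMixed h := h.sandwich _
  map_add _ _ := sandwich_add _ _ _
  posTrace_le {ρ} h := by
    have hU : U.toContinuousLinearMap.adjoint ∘L U.toContinuousLinearMap =
        ContinuousLinearMap.id ℂ _ := by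
      refine ext_inner_self fun x => ?_
      rw [ContinuousLinearMap.comp_apply, ContinuousLinearMap.adjoint_inner_right]
      exact U.inner_map_map x x
    -- An isometry together with the zero operator is a complete Kraus pair.
    rw [← posTrace_kraus (onVars X U.toContinuousLinearMap) 0 ?_ h.1]
    · exact le_self_add
    · rw [onVars_adjoint, ← onVars_comp, hU, onVars, ampL_id, Op.reindex_id,
        ContinuousLinearMap.comp_zero, add_zero]

theorem posTrace_rankOne_self {I : Type*} (ψ : Ell2 I) :
    posTrace (InnerProductSpace.rankOne ℂ ψ ψ) = ENNReal.ofReal (‖ψ‖ ^ 2) := by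
  rw [ofReal_norm_sq]
  refine tsum_congr fun i => ?_
  rw [InnerProductSpace.rankOne_apply, inner_smul_right]
  refine congrArg ENNReal.ofReal ((inner_mul_symm_re_eq_norm (𝕜 := ℂ) ψ (ket i)).trans ?_)
  rw [norm_mul, norm_inner_symm, inner_ket_left, sq]

theorem isSubchannel_init (X : Finset V) (ψ : Ell2 (AssignOn T X)) (hψ : ‖ψ‖ = 1) :
    IsSubchannel (Prog.init (T := T) X ψ hψ).denot := by
  have htr : posTrace (InnerProductSpace.rankOne ℂ ψ ψ) = 1 := by
    rw [posTrace_rankOne_self, hψ]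
    simp
  have hm : IsMixed (InnerProductSpace.rankOne ℂ ψ ψ) :=
    isMixed_iff.2 ⟨InnerProductSpace.isPositive_rankOne_self ψ, htr ▸ ENNReal.one_ne_top⟩
  refine ⟨fun h => (hm.tensor (h.reindex _).ptraceL).reindex _, fun h h' => ?_, fun {ρ} h => ?_⟩
  · rw [Prog.denot, Op.reindex_add, ptraceL_add (h.reindex _) (h'.reindex _), tensor_add_right,
      Op.reindex_add]
    rfl
  · rw [Prog.denot, posTrace_reindex, (tensor_isPositive hm.1 (h.reindex _).ptraceL.1).2, htr,
      one_mul, posTrace_ptraceL (h.reindex _), posTrace_reindex]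

/-- The state before the `n`-th evaluation of the guard of a loop. -/
abbrev loopState (X : Finset V) (M : BinMeas (AssignOn T X)) (c : Prog T) (n : ℕ) :
    Op (Assign T) → Op (Assign T) :=
  (fun σ => c.denot (restrict X M true σ))^[n]

theorem loopState_succ (X : Finset V) (M : BinMeas (AssignOn T X)) (c : Prog T) (n : ℕ)
    (ρ : Op (Assign T)) :
    loopState X M c (n + 1) ρ = c.denot (restrict X M true (loopState X M c n ρ)) :=
  Function.iterate_succ_apply' _ _ _

section Loop

variable (X : Finset V) (M : BinMeas (AssignOn T X)) {c : Prog T}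

theorem isSubchannel_loopState (hc : IsSubchannel c.denot) (n : ℕ) :
    IsSubchannel (loopState X M c n) :=
  (hc.comp (isSubchannel_restrict X M true)).iterate n

/-- Trace balance: each guard splits the current trace into an exiting and a continuing part, and
the body does not increase the latter. -/
theorem sum_posTrace_loopState_le (hc : IsSubchannel c.denot) {ρ : Op (Assign T)}
    (hρ : IsMixed ρ) (n : ℕ) :
    ∑ k ∈ Finset.range n, posTrace (restrict X M false (loopState X M c k ρ)) +
      posTrace (loopState X M c n ρ) ≤ posTrace ρ := by
  induction n with
  | zero => simp
  | succ n ih =>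
    refine le_trans ?_ ih
    have h := (isSubchannel_loopState X M hc n).isMixed hρ
    rw [Finset.sum_range_succ, add_assoc, ← posTrace_restrict_add X M h.1, loopState_succ,
      add_comm (posTrace (restrict X M true _))]
    gcongr
    exact hc.posTrace_le ((isSubchannel_restrict X M true).isMixed h)

theorem tsum_posTrace_loop_le (hc : IsSubchannel c.denot) {ρ : Op (Assign T)} (hρ : IsMixed ρ) :
    ∑' n, posTrace (restrict X M false (loopState X M c n ρ)) ≤ posTrace ρ :=
  ENNReal.tsum_le_of_sum_range_le fun n =>
    le_self_add.trans (sum_posTrace_loopState_le X M hc hρ n)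

theorem hasSum_loop (hc : IsSubchannel c.denot) {ρ : Op (Assign T)} (hρ : IsMixed ρ) :
    HasSum (fun n => restrict X M false (loopState X M c n ρ)) ((Prog.loop X M c).denot ρ) ∧
      IsMixed ((Prog.loop X M c).denot ρ) :=
  hasSum_traceSum
    (fun n => sandwich_isPositive ((isSubchannel_loopState X M hc n).isMixed hρ).1 _)
    (ne_top_of_le_ne_top hρ.posTrace_ne_top (tsum_posTrace_loop_le X M hc hρ))

theorem posTrace_loop (hc : IsSubchannel c.denot) {ρ : Op (Assign T)} (hρ : IsMixed ρ) :
    posTrace ((Prog.loop X M c).denot ρ) =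
      ∑' n, posTrace (restrict X M false (loopState X M c n ρ)) :=
  posTrace_hasSum (hasSum_loop X M hc hρ).1
    fun n => sandwich_isPositive ((isSubchannel_loopState X M hc n).isMixed hρ).1 _

theorem isSubchannel_loop (hc : IsSubchannel c.denot) :
    IsSubchannel (Prog.loop X M c).denot where
  isMixed h := (hasSum_loop X M hc h).2
  map_add h h' := by
    refine (hasSum_loop X M hc (h.add h')).1.unique ?_
    refine ((hasSum_loop X M hc h).1.add (hasSum_loop X M hc h').1).congr_fun fun n => ?_
    rw [(isSubchannel_loopState X M hc n).map_add h h', restrict, sandwich_add]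
    rfl
  posTrace_le h := by
    rw [posTrace_loop X M hc h]
    exact tsum_posTrace_loop_le X M hc h

end Loop

theorem Prog.isSubchannel (c : Prog T) : IsSubchannel c.denot := by
  induction c with
  | apply X U => exact isSubchannel_apply X U
  | init X ψ hψ => exact isSubchannel_init X ψ hψ
  | ifte X M c d hc hd =>
    have hc' := hc.comp (isSubchannel_restrict X M true)
    have hd' := hd.comp (isSubchannel_restrict X M false)
    refine ⟨fun h => (hc'.isMixed h).add (hd'.isMixed h), fun h h' => ?_, fun {ρ} h => ?_⟩
    · rw [Prog.denot, hc'.map_add h h', hd'.map_add h h', add_add_add_comm]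
      rfl
    · rw [Prog.denot, posTrace_add (hc'.isMixed h).1 (hd'.isMixed h).1,
        ← posTrace_restrict_add X M h.1]
      exact add_le_add (hc.posTrace_le (h.sandwich _)) (hd.posTrace_le (h.sandwich _))
  | loop X M c hc => exact isSubchannel_loop X M hc
  | seq c d hc hd => exact hd.comp hc
  | skip => exact ⟨fun h => h, fun _ _ => rfl, fun _ => le_rfl⟩

theorem Prog.Terminating.posTrace_eq {c : Prog T} (h : c.Terminating) {ρ : Op (Assign T)}
    (hρ : IsMixed ρ) : posTrace (c.denot ρ) = posTrace ρ := by
  have hm := c.isSubchannel.isMixed hρ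
  have := h ρ hρ
  rw [trace_eq_posTrace hm.1, trace_eq_posTrace hρ.1, Complex.ofReal_inj] at this
  exact (ENNReal.toReal_eq_toReal_iff' hm.posTrace_ne_top hρ.posTrace_ne_top).1 this

/-- By termination the exit traces add up to the whole of `tr ρ`, so the trace balance leaves
nothing in the limit for the states still inside the loop. -/
theorem tendsto_posTrace_loopState {X : Finset V} {M : BinMeas (AssignOn T X)} {c : Prog T}
    (h : (Prog.loop X M c).Terminating) {ρ : Op (Assign T)} (hρ : IsMixed ρ) :
    Filter.Tendsto (fun n => posTrace (loopState X M c n ρ)) Filter.atTop (𝓝 0) := by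
  have hsum := h.posTrace_eq hρ
  rw [posTrace_loop X M c.isSubchannel hρ] at hsum
  have h1 := ENNReal.Tendsto.sub (tendsto_const_nhds (x := posTrace ρ))
    (hsum ▸ ENNReal.tendsto_nat_tsum fun n => posTrace (restrict X M false (loopState X M c n ρ)))
    (Or.inl hρ.posTrace_ne_top)
  rw [tsub_self] at h1
  refine tendsto_of_tendsto_of_tendsto_of_le_of_le tendsto_const_nhds h1 (fun _ => zero_le)
    fun n => ?_
  have h2 := sum_posTrace_loopState_le X M c.isSubchannel hρ n
  exact ENNReal.le_sub_of_add_le_left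
    (ne_top_of_le_ne_top hρ.posTrace_ne_top (le_self_add.trans h2)) h2

end Denotation


/-! ### Separable states -/

section Separable

variable {I J : Type*}

theorem IsSeparable.tensor {σ : Op I} {τ : Op J} (hσ : IsMixed σ) (hτ : IsMixed τ) :
    IsSeparable (tensor σ τ) := by
  refine ⟨hσ.tensor hτ, Unit, fun _ => σ, fun _ => τ, fun _ => hσ, fun _ => hτ, ?_⟩
  exact traceHasSum_of_hasSum (hasSum_unique _) (fun _ => (hσ.tensor hτ).1)
    (hσ.tensor hτ).posTrace_ne_top

/-- The decompositions of all terms are merged into one family over a sigma type; its traces add up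
to `tr ρ`, so it is summable, and necessarily to `ρ`. -/
theorem IsSeparable.hasSum {ι : Type} {f : ι → Op (I × J)} {ρ : Op (I × J)}
    (hf : ∀ k, IsSeparable (f k)) (h : HasSum f ρ) (hρ : IsMixed ρ) : IsSeparable ρ := by
  choose hm κ σ τ hσ hτ hs using hf
  have hs' := fun k => hasSum_of_traceHasSum (hs k)
  have hpos : ∀ p : Σ k, κ k, (QRHL.tensor (σ p.1 p.2) (τ p.1 p.2)).IsPositive :=
    fun p => ((hσ _ _).tensor (hτ _ _)).1
  have htr : ∑' p : Σ k, κ k, posTrace (QRHL.tensor (σ p.1 p.2) (τ p.1 p.2)) = posTrace ρ := by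
    rw [ENNReal.tsum_sigma', posTrace_hasSum h fun k => (hm k).1]
    exact tsum_congr fun k => (posTrace_hasSum (hs' k) fun i => hpos ⟨k, i⟩).symm
  obtain ⟨ρ', hρ'⟩ := summable_of_posTrace hpos (htr ▸ hρ.posTrace_ne_top)
  have hsum := hρ'.sigma hs'
  rw [← h.unique hsum] at hρ'
  exact ⟨hρ, Σ k, κ k, fun p => σ p.1 p.2, fun p => τ p.1 p.2, fun p => hσ _ _,
    fun p => hτ _ _, traceHasSum_of_hasSum hρ' hpos hρ.posTrace_ne_top⟩

theorem IsSeparable.add {ρ σ : Op (I × J)} (hρ : IsSeparable ρ) (hσ : IsSeparable σ) :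
    IsSeparable (ρ + σ) := by
  refine IsSeparable.hasSum (f := fun b : Bool => bif b then ρ else σ) ?_ ?_ (hρ.1.add hσ.1)
  · rintro (_ | _)
    · exact hσ
    · exact hρ
  · convert hasSum_fintype (fun b : Bool => bif b then ρ else σ) using 1
    simp

theorem IsSeparable.sandwich_tensor {ρ : Op (I × J)} (hρ : IsSeparable ρ) (K : Op I) (L : Op J) :
    IsSeparable (sandwich (QRHL.tensor K L) ρ) := by
  obtain ⟨hm, ι, σ, τ, hσ, hτ, hs⟩ := hρ
  refine ⟨hm.sandwich _, ι, fun k => sandwich K (σ k), fun k => sandwich L (τ k),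
    fun k => (hσ k).sandwich K, fun k => (hτ k).sandwich L, ?_⟩
  refine traceHasSum_of_hasSum ?_ (fun k => (((hσ k).sandwich K).tensor ((hτ k).sandwich L)).1)
    (hm.sandwich _).posTrace_ne_top
  simp only [← QRHL.sandwich_tensor]
  exact hasSum_conj (hasSum_of_traceHasSum hs) _

theorem IsMixed.smul {ρ : Op I} (hρ : IsMixed ρ) {r : ℝ} (hr : 0 ≤ r) :
    IsMixed ((r : ℂ) • ρ) := by
  refine isMixed_iff.2 ⟨hρ.1.smul_of_nonneg (by exact_mod_cast hr), ?_⟩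
  rw [posTrace_smul hr]
  exact ENNReal.mul_ne_top ENNReal.ofReal_ne_top hρ.posTrace_ne_top

/-- Two mixed states with the same trace have a separable coupling. -/
theorem exists_coupling {σ : Op I} {τ : Op J} (hσ : IsMixed σ) (hτ : IsMixed τ)
    (h : posTrace σ = posTrace τ) :
    ∃ κ : Op (I × J), IsSeparable κ ∧ ptraceR κ = σ ∧ ptraceL κ = τ := by
  -- The coupling is the product of `t⁻¹ • σ` and `τ`. If `t = 0`, then `t⁻¹ = 0` and both states
  -- vanish, so the product still has the right marginals.
  set t := (posTrace τ).toReal with ht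
  have ht0 : 0 ≤ t⁻¹ := inv_nonneg.2 ENNReal.toReal_nonneg
  have hσ' := hσ.smul ht0
  refine ⟨QRHL.tensor _ τ, IsSeparable.tensor hσ' hτ, ?_, ?_⟩
  · rw [ptraceR_tensor hσ' hτ, ← ht, smul_smul, ← Complex.ofReal_mul]
    rcases eq_or_ne t 0 with h0 | h0
    · rw [eq_zero_of_posTrace_eq_zero hσ.1, smul_zero]
      rw [h]
      exact ((ENNReal.toReal_eq_zero_iff _).1 h0).resolve_right hτ.posTrace_ne_top
    · rw [mul_inv_cancel₀ h0, Complex.ofReal_one, one_smul]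
  · rw [ptraceL_tensor hσ' hτ, posTrace_smul ht0, h, ENNReal.toReal_mul,
      ENNReal.toReal_ofReal ht0, ← ht]
    rcases eq_or_ne t 0 with h0 | h0
    · rw [eq_zero_of_posTrace_eq_zero hτ.1, smul_zero]
      exact ((ENNReal.toReal_eq_zero_iff _).1 h0).resolve_right hτ.posTrace_ne_top
    · rw [inv_mul_cancel₀ h0, Complex.ofReal_one, one_smul]

end Separable

/-! ### Two loops run in lockstep. -/

section Loops

universe u v

variable {V : Type u} {T : V → Type v}

/-- Marginals of the synchronous part of two loops are bounded by the states of each loop. -/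
theorem mixedLE_loopState {X : Finset V} {M : BinMeas (AssignOn T X)} {c : Prog T}
    {p q : ℕ → Op (Assign T)} (hp : ∀ n, IsMixed (p n)) (hq : ∀ n, IsMixed (q n))
    (hpq : ∀ n, p (n + 1) = c.denot (q n)) (hqp : ∀ n, MixedLE (q n) (restrict X M true (p n)))
    (n : ℕ) : MixedLE (p n) (loopState X M c n (p 0)) := by
  induction n with
  | zero => exact MixedLE.refl _
  | succ n ih =>
    rw [loopState_succ, hpq]
    exact c.isSubchannel.mixedLE (hq n)
      ((hqp n).trans ((isSubchannel_restrict X M true).mixedLE (hp n) ih))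

/-- Here `p n` is a marginal of the joint state before the `n`-th guards, `q n` that of its
continuing part and `r n` that of its exiting part; the exiting parts are compared term by term with
the series defining the loop. -/
theorem mixedLE_loop {X : Finset V} {M : BinMeas (AssignOn T X)} {c : Prog T}
    {p q r : ℕ → Op (Assign T)} (hp : ∀ n, IsMixed (p n)) (hq : ∀ n, IsMixed (q n))
    (hpq : ∀ n, p (n + 1) = c.denot (q n)) (hqp : ∀ n, MixedLE (q n) (restrict X M true (p n)))
    (hrp : ∀ n, MixedLE (r n) (restrict X M false (p n))) {σ : Op (Assign T)}
    (hr : HasSum r σ) (hσ : σ.IsPositive) : MixedLE σ ((Prog.loop X M c).denot (p 0)) := by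
  have h := hasSum_loop X M c.isSubchannel (hp 0)
  exact MixedLE.hasSum (fun n => (hrp n).trans ((isSubchannel_restrict X M false).mixedLE (hp n)
    (mixedLE_loopState hp hq hpq hqp n))) hr h.1 hσ h.2

variable (X Y : Finset V) (M : BinMeas (AssignOn T X)) (N : BinMeas (AssignOn T Y))

/-- Measuring `M` on the first and `N` on the second memory with outcomes `t` and `u`. -/
def restrictBoth (t u : Bool) (ρ : Op (Assign T × Assign T)) : Op (Assign T × Assign T) :=
  sandwich (tensor (onVars X (M.op t)) (onVars Y (N.op u))) ρ

theorem sandwich_comp {I : Type*} (K L ρ : Op I) :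
    sandwich (K ∘L L) ρ = sandwich K (sandwich L ρ) := by
  rw [sandwich, ContinuousLinearMap.adjoint_comp]
  rfl

theorem onVars_complete_not (t : Bool) :
    (onVars X (M.op t)).adjoint ∘L onVars X (M.op t) +
      (onVars X (M.op !t)).adjoint ∘L onVars X (M.op !t) =
      ContinuousLinearMap.id ℂ (Ell2 (Assign T)) := by
  cases t
  · rw [add_comm]
    exact onVars_complete X M
  · exact onVars_complete X M

/-- Measuring the second memory and forgetting the outcome leaves the first marginal unchanged;
keeping only outcome `u` drops the positive contribution of `!u`. -/
theorem mixedLE_ptraceR_restrictBoth (t u : Bool) {ρ : Op (Assign T × Assign T)}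
    (hρ : IsMixed ρ) :
    MixedLE (ptraceR (restrictBoth X Y M N t u ρ)) (restrict X M t (ptraceR ρ)) := by
  have hu := hρ.sandwich (ampR (onVars Y (N.op u)))
  rw [restrictBoth, tensor, sandwich_comp, ptraceR_sandwich_ampL hu]
  exact (isSubchannel_restrict X M t).mixedLE hu.ptraceR
    ⟨_, (hρ.sandwich _).ptraceR, ptraceR_sandwich_ampR_add hρ _ _ (onVars_complete_not Y N u)⟩

theorem mixedLE_ptraceL_restrictBoth (t u : Bool) {ρ : Op (Assign T × Assign T)}
    (hρ : IsMixed ρ) :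
    MixedLE (ptraceL (restrictBoth X Y M N t u ρ)) (restrict Y N u (ptraceL ρ)) := by
  have ht := hρ.sandwich (ampL (onVars X (M.op t)))
  rw [restrictBoth, ← ampR_comp_ampL, sandwich_comp, ptraceL_sandwich_ampR ht]
  exact (isSubchannel_restrict Y N u).mixedLE ht.ptraceL
    ⟨_, (hρ.sandwich _).ptraceL, ptraceL_sandwich_ampL_add hρ _ _ (onVars_complete_not X M t)⟩

theorem restrictStar_eq (t u : Bool) (A : Op (Assign T × Assign T)) :
    restrictStar X Y M N t u A =
      (tensor (onVars X (M.op t)) (onVars Y (N.op u))).adjoint ∘L A ∘L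
        tensor (onVars X (M.op t)) (onVars Y (N.op u)) := by
  rw [← ampR_comp_ampL, ContinuousLinearMap.adjoint_comp]
  rfl

theorem restrictStar_isPositive (t u : Bool) {A : Op (Assign T × Assign T)} (hA : A.IsPositive) :
    (restrictStar X Y M N t u A).IsPositive := by
  rw [restrictStar_eq]
  exact hA.adjoint_conj _

theorem pairing_restrictStar (t u : Bool) {A ρ : Op (Assign T × Assign T)} (hA : A.IsPositive)
    (hρ : ρ.IsPositive) :
    pairing (restrictStar X Y M N t u A) ρ = pairing A (restrictBoth X Y M N t u ρ) := by
  rw [restrictStar_eq, pairing_conj hA hρ]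
  rfl

theorem RHL_iff_pairing {A B : Op (Assign T × Assign T)} (hA : A.IsPositive) (hB : B.IsPositive)
    (c d : Prog T) :
    RHL A c d B ↔ ∀ ρ : Op (Assign T × Assign T), IsSeparable ρ →
      ∃ ρ' : Op (Assign T × Assign T), IsSeparable ρ' ∧ ptraceR ρ' = c.denot (ptraceR ρ) ∧
        ptraceL ρ' = d.denot (ptraceL ρ) ∧ pairing A ρ ≤ pairing B ρ' := by
  refine forall₂_congr fun ρ hρ => exists_congr fun ρ' => and_congr_right fun hρ' =>
    and_congr_right fun _ => and_congr_right fun _ => ?_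
  rw [trace_comp hA hρ.1, trace_comp hB hρ'.1, Complex.ofReal_re, Complex.ofReal_re,
    ENNReal.toReal_le_toReal (pairing_ne_top A hρ.1) (pairing_ne_top B hρ'.1)]

theorem pairing_hasSum {I ι : Type*} (A : Op I) {f : ι → Op I} {σ : Op I} (h : HasSum f σ)
    (hf : ∀ k, (f k).IsPositive) : pairing A σ = ∑' k, pairing A (f k) :=
  posTrace_hasSum (hasSum_conj h _) fun k => sandwich_isPositive (hf k) _

/-- Telescoping gives `a 0 + b 0 ≤ a n + ∑_{k ≤ n} b k`, and then `n` tends to infinity. -/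
theorem le_tsum_of_le_succ {a b : ℕ → ℝ≥0∞} (h : ∀ n, a n ≤ a (n + 1) + b (n + 1))
    (ha : Filter.Tendsto a Filter.atTop (𝓝 0)) : a 0 + b 0 ≤ ∑' n, b n := by
  have h1 : ∀ n, a 0 + b 0 ≤ a n + ∑' k, b k := fun n => by
    have h2 : a 0 + b 0 ≤ a n + ∑ k ∈ Finset.range (n + 1), b k := by
      induction n with
      | zero => simp
      | succ n ih =>
        refine ih.trans ((add_le_add_left (h n) _).trans_eq ?_)
        rw [Finset.sum_range_succ _ (n + 1)]
        ring
    exact h2.trans (add_le_add_right (ENNReal.sum_le_tsum _) _)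
  have h3 := ha.add (tendsto_const_nhds (x := ∑' k, b k))
  rw [zero_add] at h3
  exact ge_of_tendsto' h3 h1

end Loops

end

end QRHL

/-! ### Soundness of the JointWhile rule. -/

theorem mainTheorem1 {V : Type*} {T : V → Type*} [∀ x, Nonempty (T x)]
    (X Y : Finset V) (M : BinMeas (AssignOn T X)) (N : BinMeas (AssignOn T Y))
    (c d : Prog T) (A B : Op (Assign T × Assign T)) (hA : A.IsPositive) (hB : B.IsPositive)
    (hbody : RHL A c d
      (restrictStar X Y M N true true A + restrictStar X Y M N false false B))
    (hc : c.Terminating) (hd : d.Terminating)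
    (hwc : (Prog.loop X M c).Terminating) (hwd : (Prog.loop Y N d).Terminating) :
    RHL (restrictStar X Y M N true true A + restrictStar X Y M N false false B)
      (Prog.loop X M c) (Prog.loop Y N d) B := by
  have hAt := restrictStar_isPositive X Y M N true true hA
  have hBf := restrictStar_isPositive X Y M N false false hB
  rw [RHL_iff_pairing hA (hAt.add hBf)] at hbody
  rw [RHL_iff_pairing (hAt.add hBf) hB]
  intro ρ hρ
  choose F hFs hFR hFL hFp using hbody
  have hsep : ∀ {σ} t u, IsSeparable σ → IsSeparable (restrictBoth X Y M N t u σ) :=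
    fun t u h => h.sandwich_tensor _ _
  -- The lockstep run: the body judgment is applied to the both-true part of the current state.
  -- Separability is carried along because the judgment requires it.
  let s : ℕ → {σ : Op (Assign T × Assign T) // IsSeparable σ} := fun n =>
    Nat.rec ⟨ρ, hρ⟩ (fun _ σ => ⟨F _ (hsep true true σ.2), hFs _ _⟩) n
  have hs : ∀ n, IsSeparable (s n).1 := fun n => (s n).2
  have hst := fun n => (hsep true true (hs n)).1
  have hsf := fun n => (hsep false false (hs n)).1
  have hp := fun n => (hs n).1.ptraceR
  have hq := fun n => (hst n).ptraceR
  have hp' := fun n => (hs n).1.ptraceL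
  have hq' := fun n => (hst n).ptraceL
  have hpq : ∀ n, ptraceR (s (n + 1)).1 = c.denot (ptraceR (restrictBoth X Y M N true true (s n).1)) :=
    fun n => hFR _ _
  have hpq' : ∀ n, ptraceL (s (n + 1)).1 = d.denot (ptraceL (restrictBoth X Y M N true true (s n).1)) :=
    fun n => hFL _ _
  have hqp := fun n => mixedLE_ptraceR_restrictBoth X Y M N true true (hs n).1
  have hqp' := fun n => mixedLE_ptraceL_restrictBoth X Y M N true true (hs n).1
  have hrp := fun n => mixedLE_ptraceR_restrictBoth X Y M N false false (hs n).1
  have hrp' := fun n => mixedLE_ptraceL_restrictBoth X Y M N false false (hs n).1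
  have hle : ∀ n, MixedLE (ptraceR (s n).1) (loopState X M c n (ptraceR ρ)) :=
    mixedLE_loopState hp hq hpq hqp
  -- the sum of the synchronously terminated parts
  have hsum : ∑' n, posTrace (restrictBoth X Y M N false false (s n).1) ≠ ∞ := by
    refine ne_top_of_le_ne_top hρ.1.ptraceR.posTrace_ne_top
      (le_trans (ENNReal.tsum_le_tsum fun n => ?_)
        (tsum_posTrace_loop_le X M c.isSubchannel hρ.1.ptraceR))
    rw [← posTrace_ptraceR (hsf n)]
    exact ((hrp n).trans ((isSubchannel_restrict X M false).mixedLE (hp n) (hle n))).posTrace_le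
      (hsf n).ptraceR.1
  obtain ⟨hτ, hτm⟩ := hasSum_traceSum (fun n => (hsf n).1) hsum
  set τ := traceSum fun n => restrictBoth X Y M N false false (s n).1
  -- `R`, and `L` below, are the parts of the two loop outputs not accounted for by synchronous
  -- termination.
  obtain ⟨R, hR, hRτ⟩ := mixedLE_loop hp hq hpq hqp hrp (hasSum_ptraceR hτ hsf hτm) hτm.ptraceR.1
  obtain ⟨L, hL, hLτ⟩ :=
    mixedLE_loop hp' hq' hpq' hqp' hrp' (hasSum_ptraceL hτ hsf hτm) hτm.ptraceL.1
  -- what is missing in the two marginals has the same trace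
  have htr : posTrace R = posTrace L := by
    have h1 := hwc.posTrace_eq hρ.1.ptraceR
    have h2 := hwd.posTrace_eq hρ.1.ptraceL
    change posTrace ((Prog.loop X M c).denot (ptraceR (s 0).1)) = _ at h1
    change posTrace ((Prog.loop Y N d).denot (ptraceL (s 0).1)) = _ at h2
    rw [← hRτ, posTrace_add hτm.ptraceR.1 hR.1, posTrace_ptraceR hτm, posTrace_ptraceR hρ.1] at h1
    rw [← hLτ, posTrace_add hτm.ptraceL.1 hL.1, posTrace_ptraceL hτm, posTrace_ptraceL hρ.1] at h2
    exact (ENNReal.add_right_inj hτm.posTrace_ne_top).1 (h1.trans h2.symm)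
  obtain ⟨κ, hκ, hκR, hκL⟩ := exists_coupling hR hL htr
  refine ⟨τ + κ, (IsSeparable.hasSum (fun n => hsep false false (hs n)) hτ hτm).add hκ, ?_, ?_, ?_⟩
  · rw [ptraceR_add hτm hκ.1, hκR]
    exact hRτ
  · rw [ptraceL_add hτm hκ.1, hκL]
    exact hLτ
  have hsplit : ∀ n, pairing
      (restrictStar X Y M N true true A + restrictStar X Y M N false false B) (s n).1 =
      pairing A (restrictBoth X Y M N true true (s n).1) +
        pairing B (restrictBoth X Y M N false false (s n).1) := fun n => by
    rw [pairing_add_left hAt hBf (hs n).1.1, pairing_restrictStar X Y M N _ _ hA (hs n).1.1,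
      pairing_restrictStar X Y M N _ _ hB (hs n).1.1]
  -- The value of `A` is at most a constant times the trace, and the trace of the both-true part is
  -- bounded through its first marginal by that of the `n`-th state of the left loop.
  have hlim : Filter.Tendsto (fun n => pairing A (restrictBoth X Y M N true true (s n).1))
      Filter.atTop (𝓝 0) := by
    have h1 := ENNReal.Tendsto.const_mul (a := ENNReal.ofReal (‖opSqrt A‖ ^ 2))
      (tendsto_posTrace_loopState hwc hρ.1.ptraceR) (Or.inr ENNReal.ofReal_ne_top)
    rw [mul_zero] at h1
    refine tendsto_of_tendsto_of_tendsto_of_le_of_le tendsto_const_nhds h1 (fun _ => zero_le)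
      fun n => (pairing_le A (hst n).1).trans (mul_le_mul_right ?_ _)
    rw [← posTrace_ptraceR (hst n)]
    exact ((hqp n).posTrace_le (hq n).1).trans
      (((isSubchannel_restrict X M true).posTrace_le (hp n)).trans ((hle n).posTrace_le (hp n).1))
  -- The body judgment bounds the value of `A` on the both-true part of `s n` by the full
  -- precondition on `s (n + 1)`, which splits again; this is the hypothesis of the telescoping
  -- lemma.
  calc pairing _ ρ = _ := hsplit 0
    _ ≤ ∑' n, pairing B (restrictBoth X Y M N false false (s n).1) :=
        le_tsum_of_le_succ (fun n => (hFp _ (hsep true true (hs n))).trans_eq (hsplit (n + 1))) hlim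
    _ = pairing B τ := (pairing_hasSum B hτ fun n => (hsf n).1).symm
    _ ≤ pairing B (τ + κ) := by
        rw [pairing_add_right hτm.1 hκ.1.1]
        exact le_self_add
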